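/- Let $G$ be a reductive (affine) algebraic group over $\mathbb{C}$, $T\subset G$ a maximal torus, $\mathfrak g$, $\mathfrak t$ their Lie algebras, $\Phi\subset\mathfrak t^\vee$ the set of roots, $\mathfrak u_\gamma\subset\mathfrak g$ the root space and $U_\gamma=\exp(\mathfrak u_\gamma)\subset G$ the root subgroup of $\gamma\in\Phi$. A set $C\subset\Phi$ is called convex if $C\subset\Phi_+$ for some polarization $\Phi=\Phi_+\sqcup\Phi_-$, and then $\mathrm{Conv}^{\mathbb N}_C$ denotes the set of all roots that are linear combinations of elements of $C$ with coefficients in $\mathbb N=\{0,1,2,\dots\}$. Let $C_{in}\subset\Phi$ be a convex set and $C_{out}=\mathrm{Conv}^{\mathbb N}_{C_{in}}$. An (undecorated) 2D scattering diagram consists of finitely many oriented rays in $\mathbb R^2$, supported on pairwise distinct half-lines with endpoint $0$, each either incoming (ending at $0$) or outgoing (starting at $0$), together with a bijection between the incoming rays and $C_{in}$ and a bijection between the outgoing rays and $C_{out}$. Given $u_\gamma\in U_\gamma$ for $\gamma\in C_{in}$ and $u'_\gamma\in U_\gamma$ for $\gamma\in C_{out}$, let $$u_{C_{out}}:=\overrightarrow{\prod_{\text{rays}}}\,(u^{(\prime)}_\gamma)^{\pm1}\in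 G$$ be the product over all rays in clockwise order around $0$, where an incoming ray labelled $\gamma$ contributes $u_\gamma^{-1}$ and an outgoing ray labelled $\gamma$ contributes $u'_\gamma$. (The condition $u_{C_{out}}=\mathrm{id}$ does not depend on where the product starts.) Then every 2D scattering diagram has a unique solution, that is, there is a unique morphism of schemes over $\mathbb C$ $$s:\prod_{\gamma\in C_{in}}U_\gamma\longrightarrow\prod_{\gamma\in C_{out}}U_\gamma,\qquad (u_\gamma)_{\gamma\in C_{in}}\longmapsto(u'_\gamma)_{\gamma\in C_{out}},$$ such that $u_{C_{out}}=\mathrm{id}$ identically on $\prod_{\gamma\in C_{in}}U_\gamma$. Furthermore, for every fixed decoration $(u_\gamma)_{\gamma\in C_{in}}$ of the incoming rays by elements $u_\gamma\in U_\gamma(\mathbb C)$, the tuple $s((u_\gamma)_{\gamma\in C_{in}})$ is the unique tuple $(u'_\gamma)_{\gamma\in C_{out}}$ of elements $u'_\gamma\in U_\gamma(\mathbb C)$ such that $u_{C_{out}}=\mathrm{id}$. -/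

import Mathlib

open CategoryTheory AlgebraicGeometry

noncomputable section

namespace StokesScattering

/-! ### Affine algebraic groups over `ℂ`

An affine algebraic group `G` over `ℂ` is given by its coordinate ring, a finitely generated
commutative Hopf algebra `A`, so that `G = Spec A`; closed subgroups of `G` correspond to Hopf
ideals of `A`. -/

section Groups

variable (A : Type) [CommRing A] [HopfAlgebra ℂ A]

/-- The group scheme `G = Spec A`, as an object over `Spec ℂ`; Mathlib makes it a group object. -/
abbrev grp : Over (Spec (.of ℂ)) := (Spec (.of A)).asOver (Spec (.of ℂ))

/-- The linear dual of `A` with the convolution product. It contains the group `G(ℂ)` as well as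
the Lie algebra of `G`. -/
abbrev ConvDual : Type := WithConv (A →ₗ[ℂ] ℂ)

variable {A}

/-- Right translation by `g ∈ G(ℂ)` on the coordinate ring, `(ρ_g f)(x) = f(x g)`. -/
def rightTranslation (g : A →ₐ[ℂ] ℂ) : Module.End ℂ A :=
  (TensorProduct.rid ℂ A).toLinearMap ∘ₗ g.toLinearMap.lTensor A ∘ₗ Coalgebra.comul

variable (A) in
/-- A group is unipotent if all its elements are: right translation by `g` on the coordinate ring
is locally unipotent. -/
def IsUnipotent : Prop :=
  ∀ (g : A →ₐ[ℂ] ℂ) (f : A), ∃ n : ℕ, ((rightTranslation g - 1) ^ n) f = 0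

variable (A) in
/-- A torus: a group isomorphic to `𝔾_m ^ r`, whose coordinate ring is `ℂ[ℤ ^ r]`. -/
def IsTorus : Prop :=
  ∃ r : ℕ, Nonempty (A ≃ₐc[ℂ] MonoidAlgebra ℂ (Multiplicative (Fin r → ℤ)))

/-- The closed subgroup `H` cut out by the ideal `I` is normal: `g h g⁻¹ ∈ H(R)` for all
commutative `ℂ`-algebras `R`, all `g ∈ G(R)` and all `h ∈ H(R)`. The group law of `G(R)` is the
convolution product, and `g⁻¹` is `g` composed with the antipode. -/
def IsNormalSubgroup (I : Ideal A) : Prop :=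
  ∀ (R : Type) [CommRing R] [Algebra ℂ R] (g h : A →ₐ[ℂ] R), (∀ f ∈ I, h f = 0) →
    ∀ f ∈ I, (WithConv.toConv g * WithConv.toConv h *
      WithConv.toConv (g.comp (HopfAlgebra.antipodeAlgHom ℂ A))) f = 0

variable (A) in
/-- `G` is reductive: its unipotent radical is trivial, that is, every connected normal unipotent
closed subgroup is the trivial subgroup. -/
def IsReductive : Prop :=
  ∀ (I : Ideal A) [I.IsHopfIdeal ℂ], IsNormalSubgroup I → IsUnipotent (A ⧸ I) →
    ConnectedSpace (PrimeSpectrum (A ⧸ I)) → I = RingHom.ker (Bialgebra.counitAlgHom ℂ A)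

/-- The ideal `J` cuts out a subtorus of `G`. -/
def IsSubtorus (J : Ideal A) : Prop := ∃ _ : J.IsHopfIdeal ℂ, IsTorus (A ⧸ J)

/-- The ideal `J` cuts out a maximal torus of `G`. -/
def IsMaximalTorus (J : Ideal A) : Prop :=
  IsSubtorus J ∧ ∀ J' : Ideal A, IsSubtorus J' → J' ≤ J → J' = J

end Groups

/-! ### Lie algebra, roots, root subgroups -/

section Roots

variable (A : Type) [CommRing A] [HopfAlgebra ℂ A]

/-- The Lie algebra `𝔤` of `G`: the point derivations of `A` at the identity. Its bracket is the
commutator `⁅X, Y⁆ = X * Y - Y * X` of the convolution product. -/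
def lieAlg : Submodule ℂ (ConvDual A) where
  carrier := {X | ∀ a b : A, X (a * b) = Coalgebra.counit a * X b + X a * Coalgebra.counit b}
  add_mem' := by
    intro X Y hX hY a b
    have h : ∀ c, (X + Y) c = X c + Y c := fun c => rfl
    rw [h, h, h, hX, hY]; ring
  zero_mem' := by
    intro a b
    have h : ∀ c, (0 : ConvDual A) c = 0 := fun c => rfl
    rw [h, h, h]; ring
  smul_mem' := by
    intro t X hX a b
    have h : ∀ c, (t • X) c = t * X c := fun c => rfl
    rw [h, h, h, hX]; ring

variable {A} (J : Ideal A)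

/-- The Lie algebra `𝔱 ⊆ 𝔤` of the closed subgroup cut out by `J`. -/
def cartan : Submodule ℂ (ConvDual A) where
  carrier := {H | H ∈ lieAlg A ∧ ∀ f ∈ J, H f = 0}
  add_mem' := fun hX hY => ⟨add_mem hX.1 hY.1, fun f hf => by
    have h : ∀ c, ∀ X Y : ConvDual A, (X + Y) c = X c + Y c := fun c _ _ => rfl
    rw [h, hX.2 f hf, hY.2 f hf, add_zero]⟩
  zero_mem' := ⟨zero_mem _, fun _ _ => rfl⟩
  smul_mem' := fun t X hX => ⟨Submodule.smul_mem _ t hX.1, fun f hf => by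
    have h : (t • X) f = t * X f := rfl
    rw [h, hX.2 f hf, mul_zero]⟩

/-- The root space `𝔤_α = 𝔲_α` of a linear form `α` on `𝔱`. -/
def rootSpace (α : Module.Dual ℂ (cartan J)) : Submodule ℂ (ConvDual A) where
  carrier := {X | X ∈ lieAlg A ∧ ∀ H : cartan J, ⁅(H : ConvDual A), X⁆ = α H • X}
  add_mem' := fun hX hY => ⟨add_mem hX.1 hY.1, fun H => by
    rw [smul_add, ← hX.2, ← hY.2, Ring.lie_def, Ring.lie_def, Ring.lie_def]; noncomm_ring⟩
  zero_mem' := ⟨zero_mem _, fun H => by rw [Ring.lie_def, smul_zero, mul_zero, zero_mul, sub_zero]⟩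
  smul_mem' := fun t X hX => ⟨Submodule.smul_mem _ t hX.1, fun H => by
    rw [Ring.lie_def, mul_smul_comm, smul_mul_assoc, ← smul_sub, ← Ring.lie_def, hX.2, smul_comm]⟩

/-- The set of roots `Φ ⊆ 𝔱^∨`. -/
def roots : Set (Module.Dual ℂ (cartan J)) := {α | α ≠ 0 ∧ rootSpace J α ≠ ⊥}

/-- A polarization `Φ = Φ₊ ⊔ Φ₋`: the roots are separated into positive and negative ones by a
real linear functional that does not vanish at any root. -/
def IsPolarization (Φp Φm : Set (Module.Dual ℂ (cartan J))) : Prop :=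
  ∃ l : Module.Dual ℂ (cartan J) →ₗ[ℝ] ℝ, (∀ α ∈ roots J, l α ≠ 0) ∧
    Φp = {α ∈ roots J | 0 < l α} ∧ Φm = {α ∈ roots J | l α < 0}

/-- A set of roots is convex if it consists of positive roots for some polarization. -/
def IsConvexRoots (C : Set (Module.Dual ℂ (cartan J))) : Prop :=
  ∃ Φp Φm, IsPolarization J Φp Φm ∧ C ⊆ Φp

/-- The restricted convex hull: all roots which are linear combinations of elements of `C` with
coefficients in `ℕ = {0, 1, 2, …}`. -/
def restrictedConv (C : Set (Module.Dual ℂ (cartan J))) : Set (Module.Dual ℂ (cartan J)) :=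
  {γ ∈ roots J | γ ∈ AddSubmonoid.closure C}

/-- The point `g ∈ G(ℂ)` is the exponential of `X`: `f(exp X) = ∑ n, Xⁿ(f) / n!` for every
regular function `f` on `G`. -/
def IsExp (X : ConvDual A) (g : A →ₐ[ℂ] ℂ) : Prop :=
  ∀ f : A, HasSum (fun n : ℕ => ((n.factorial : ℂ))⁻¹ * (X ^ n) f) (g f)

/-- The ideal of all regular functions on `G` vanishing on `exp (𝔲_α)`. -/
def rootSubgroupIdeal (α : Module.Dual ℂ (cartan J)) : Ideal A :=
  ⨅ g ∈ {g : A →ₐ[ℂ] ℂ | ∃ X ∈ rootSpace J α, IsExp X g}, RingHom.ker g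

/-- The root subgroup `U_α = exp (𝔲_α)`, as a reduced closed subscheme of `G` over `Spec ℂ`. -/
def rootSubgroup (α : Module.Dual ℂ (cartan J)) : Over (Spec (.of ℂ)) :=
  (Spec (.of (A ⧸ rootSubgroupIdeal J α))).asOver (Spec (.of ℂ))

/-- The closed immersion `U_α ⟶ G`. -/
def rootSubgroupIncl (α : Module.Dual ℂ (cartan J)) : rootSubgroup J α ⟶ grp A :=
  Over.homMk (Spec.map (CommRingCat.ofHom (Ideal.Quotient.mk (rootSubgroupIdeal J α))))
    ((Spec.map_comp _ _).symm)

end Roots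

/-! ### 2D scattering diagrams -/

/-- The clockwise angle, in `[0, 2π)`, from the direction `a` to the direction `b`. Directions in
the plane are given by their angle, measured counterclockwise from the positive `x`-axis. -/
def clockwiseAngle (a b : Real.Angle) : ℝ := toIcoMod Real.two_pi_pos 0 (a - b).toReal

theorem clockwiseAngle_mem (a b : Real.Angle) : clockwiseAngle a b ∈ Set.Ico 0 (2 * Real.pi) := by
  simpa [clockwiseAngle] using toIcoMod_mem_Ico Real.two_pi_pos 0 (a - b).toReal

theorem coe_clockwiseAngle (a b : Real.Angle) : (clockwiseAngle a b : Real.Angle) = a - b := by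
  rw [clockwiseAngle, toIcoMod, Real.Angle.coe_sub, zsmul_eq_mul, mul_comm,
    Real.Angle.coe_toReal, sub_eq_self, Real.Angle.coe_eq_zero_iff]
  exact ⟨_, by rw [zsmul_eq_mul, mul_comm]⟩

theorem eq_of_coe_eq {x y : ℝ} (hx : x ∈ Set.Ico 0 (2 * Real.pi))
    (hy : y ∈ Set.Ico 0 (2 * Real.pi)) (h : (x : Real.Angle) = y) : x = y := by
  obtain ⟨k, hk⟩ := Real.Angle.angle_eq_iff_two_pi_dvd_sub.1 h
  have hpi := Real.two_pi_pos
  have h1 : (k : ℝ) < 1 := by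
    by_contra! hc
    nlinarith [hx.2, hy.1]
  have h2 : (-1 : ℝ) < k := by
    by_contra! hc
    nlinarith [hx.1, hy.2]
  have hk0 : k = 0 := by
    have h1' : k < 1 := by exact_mod_cast h1
    have h2' : -1 < k := by exact_mod_cast h2
    omega
  rw [hk0] at hk
  push_cast at hk
  linarith

theorem clockwiseAngle_injective (a : Real.Angle) : Function.Injective (clockwiseAngle a) := by
  intro x y h
  have := congrArg (fun t : ℝ => (t : Real.Angle)) h
  simpa [coe_clockwiseAngle] using this

theorem clockwiseAngle_change (a b x : Real.Angle) : clockwiseAngle b x =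
    if clockwiseAngle a x < clockwiseAngle a b
    then clockwiseAngle a x - clockwiseAngle a b + 2 * Real.pi
    else clockwiseAngle a x - clockwiseAngle a b := by
  have hx := clockwiseAngle_mem a x
  have hb := clockwiseAngle_mem a b
  split_ifs with h
  · refine eq_of_coe_eq (clockwiseAngle_mem _ _) ⟨by linarith [hx.1, hb.2], by linarith⟩ ?_
    rw [Real.Angle.coe_add, Real.Angle.coe_sub, Real.Angle.coe_two_pi]
    simp only [coe_clockwiseAngle]
    abel
  · refine eq_of_coe_eq (clockwiseAngle_mem _ _) ⟨by linarith, by linarith [hx.2, hb.1]⟩ ?_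
    rw [Real.Angle.coe_sub]
    simp only [coe_clockwiseAngle]
    abel

/-- An (undecorated) 2D scattering diagram for the roots with respect to `J`: incoming rays
labelled bijectively by a convex set `Cin` of roots, outgoing rays labelled bijectively by its
restricted convex hull. A ray is a half-line `{r (cos θ, sin θ) | r ≥ 0}`, oriented towards the
origin if it is incoming and away from it if it is outgoing; it is given by `θ`. There are finitely
many rays and their half-lines are distinct. -/
structure ScatteringDiagram {A : Type} [CommRing A] [HopfAlgebra ℂ A] (J : Ideal A) where
  /-- labels of the incoming rays -/
  Cin : Set (Module.Dual ℂ (cartan J))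
  convex : IsConvexRoots J Cin
  finite_in : Cin.Finite
  finite_out : (restrictedConv J Cin).Finite
  /-- direction of the half-line supporting an incoming ray -/
  dirIn : Cin → Real.Angle
  /-- direction of the half-line supporting an outgoing ray -/
  dirOut : restrictedConv J Cin → Real.Angle
  distinct : Function.Injective (Sum.elim dirIn dirOut)

namespace ScatteringDiagram

variable {A : Type} [CommRing A] [HopfAlgebra ℂ A] {J : Ideal A} (D : ScatteringDiagram J)

/-- Labels of the outgoing rays. -/
abbrev Cout : Set (Module.Dual ℂ (cartan J)) := restrictedConv J D.Cin

instance : Finite D.Cin := D.finite_in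

instance : Finite D.Cout := D.finite_out

/-- The set of all rays. -/
abbrev Rays : Type := D.Cin ⊕ D.Cout

instance : Fintype D.Rays := Fintype.ofFinite _

/-- The direction of the half-line supporting a ray. -/
def dir : D.Rays → Real.Angle := Sum.elim D.dirIn D.dirOut

attribute [local instance] Hom.group

open Classical in
/-- The list of all rays in the clockwise order in which they are met when one turns once around
the origin, starting at the direction `a`. -/
def clockwise (a : Real.Angle) : List D.Rays :=
  Finset.univ.toList.insertionSort
    (fun r r' => clockwiseAngle a (D.dir r) ≤ clockwiseAngle a (D.dir r'))

/-- The clockwise-ordered product of all Stokes factors, starting at the direction `a`, with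
exponent `-1` for incoming and `+1` for outgoing rays. The Stokes factors are `S`-valued points
of the root subgroups, and the product is taken in the group `G(S)`. -/
def stokesProduct (a : Real.Angle) {S : Over (Spec (.of ℂ))}
    (u : ∀ γ : D.Cin, S ⟶ rootSubgroup J γ.1) (u' : ∀ γ : D.Cout, S ⟶ rootSubgroup J γ.1) :
    S ⟶ grp A :=
  ((D.clockwise a).map (Sum.elim (fun γ => (u γ ≫ rootSubgroupIncl J γ.1)⁻¹)
    (fun γ => u' γ ≫ rootSubgroupIncl J γ.1))).prod

/-- Stokes factors `u` on the incoming and `u'` on the outgoing rays decorate the diagram: the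
clockwise-ordered product is the identity, wherever one starts. -/
def IsDecoration {S : Over (Spec (.of ℂ))}
    (u : ∀ γ : D.Cin, S ⟶ rootSubgroup J γ.1) (u' : ∀ γ : D.Cout, S ⟶ rootSubgroup J γ.1) :
    Prop :=
  ∀ a : Real.Angle, D.stokesProduct a u u' = 1

theorem mem_clockwise (a : Real.Angle) (r : D.Rays) : r ∈ D.clockwise a :=
  (List.mem_insertionSort _).2 (by simp)

theorem nodup_clockwise (a : Real.Angle) : (D.clockwise a).Nodup :=
  (List.perm_insertionSort _ _).nodup_iff.2 (Finset.nodup_toList _)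

theorem pairwise_clockwise (a : Real.Angle) : (D.clockwise a).Pairwise
    (fun r r' => clockwiseAngle a (D.dir r) < clockwiseAngle a (D.dir r')) := by
  classical
  have h1 : (D.clockwise a).Pairwise
      (fun r r' => clockwiseAngle a (D.dir r) ≤ clockwiseAngle a (D.dir r')) := by
    have : Std.Total (fun r r' : D.Rays =>
        clockwiseAngle a (D.dir r) ≤ clockwiseAngle a (D.dir r')) := ⟨fun _ _ => le_total _ _⟩
    have : IsTrans D.Rays (fun r r' : D.Rays =>
        clockwiseAngle a (D.dir r) ≤ clockwiseAngle a (D.dir r')) := ⟨fun _ _ _ => le_trans⟩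
    exact List.pairwise_insertionSort _ _
  refine (h1.and (D.nodup_clockwise a)).imp fun {r r'} h => lt_of_le_of_ne h.1 fun he => h.2 ?_
  exact D.distinct (clockwiseAngle_injective a he)

theorem clockwise_eq (a : Real.Angle) (l : List D.Rays) (hl : l.Perm (D.clockwise a))
    (h : l.Pairwise
      (fun r r' => clockwiseAngle a (D.dir r) < clockwiseAngle a (D.dir r'))) :
    l = D.clockwise a :=
  List.Perm.eq_of_pairwise (fun _ _ _ _ h1 h2 => absurd h1 (lt_asymm h2)) h
    (D.pairwise_clockwise a) hl

/-- Turning the starting direction rotates the list of rays. -/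
theorem clockwise_rotate (a b : Real.Angle) : ∃ l l' : List D.Rays,
    D.clockwise a = l ++ l' ∧ D.clockwise b = l' ++ l := by
  classical
  let p : D.Rays → Bool := fun r => decide (clockwiseAngle a (D.dir r) < clockwiseAngle a b)
  have hp : ((D.clockwise a).filter p ++ (D.clockwise a).filter (fun r => !p r)).Perm
      (D.clockwise a) := List.filter_append_perm p _
  have hab : (D.clockwise a).Perm (D.clockwise b) :=
    (List.perm_insertionSort _ _).trans (List.perm_insertionSort _ _).symm
  have h1 : ∀ r, p r = true → clockwiseAngle b (D.dir r) =
      clockwiseAngle a (D.dir r) - clockwiseAngle a b + 2 * Real.pi := fun r hr => by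
    rw [clockwiseAngle_change a b, if_pos (of_decide_eq_true hr)]
  have h2 : ∀ r, (!p r) = true → clockwiseAngle b (D.dir r) =
      clockwiseAngle a (D.dir r) - clockwiseAngle a b := fun r hr => by
    rw [clockwiseAngle_change a b, if_neg (by simpa [p] using hr)]
  refine ⟨_, _, (D.clockwise_eq a _ hp ?_).symm,
    (D.clockwise_eq b _ ((List.perm_append_comm.trans hp).trans hab) ?_).symm⟩
  · refine List.pairwise_append.2 ⟨(D.pairwise_clockwise a).filter _,
      (D.pairwise_clockwise a).filter _, fun r hr r' hr' => ?_⟩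
    have e1 := (List.mem_filter.1 hr).2
    have e2 := (List.mem_filter.1 hr').2
    simp only [p, decide_eq_true_eq, Bool.not_eq_true', decide_eq_false_iff_not, not_lt] at e1 e2
    exact e1.trans_le e2
  · refine List.pairwise_append.2 ⟨?_, ?_, fun r hr r' hr' => ?_⟩
    · refine ((D.pairwise_clockwise a).filter _).imp_of_mem fun {r r'} hr hr' h => ?_
      rw [h2 r (List.mem_filter.1 hr).2, h2 r' (List.mem_filter.1 hr').2]
      linarith
    · refine ((D.pairwise_clockwise a).filter _).imp_of_mem fun {r r'} hr hr' h => ?_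
      rw [h1 r (List.mem_filter.1 hr).2, h1 r' (List.mem_filter.1 hr').2]
      linarith
    · rw [h2 r (List.mem_filter.1 hr).2, h1 r' (List.mem_filter.1 hr').2]
      have := (clockwiseAngle_mem a (D.dir r)).2
      have := (clockwiseAngle_mem a (D.dir r')).1
      linarith

/-- The condition that the clockwise-ordered product is the identity does not depend on where one
starts. -/
theorem stokesProduct_eq_one_iff (a b : Real.Angle) {S : Over (Spec (.of ℂ))}
    (u : ∀ γ : D.Cin, S ⟶ rootSubgroup J γ.1) (u' : ∀ γ : D.Cout, S ⟶ rootSubgroup J γ.1) :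
    D.stokesProduct a u u' = 1 ↔ D.stokesProduct b u u' = 1 := by
  obtain ⟨l, l', h, h'⟩ := D.clockwise_rotate a b
  rw [stokesProduct, stokesProduct, h, h', List.map_append, List.map_append, List.prod_append,
    List.prod_append, mul_eq_one_iff_eq_inv, mul_eq_one_iff_eq_inv', eq_comm (b := _⁻¹)]

/-- The scheme `∏_{γ ∈ Cin} U_γ` (a product over `Spec ℂ`). -/
abbrev prodIn : Over (Spec (.of ℂ)) := ∏ᶜ fun γ : D.Cin => rootSubgroup J γ.1

/-- The scheme `∏_{γ ∈ Cout} U_γ` (a product over `Spec ℂ`). -/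
abbrev prodOut : Over (Spec (.of ℂ)) := ∏ᶜ fun γ : D.Cout => rootSubgroup J γ.1

/-- A solution of the scattering diagram: a morphism of schemes over `ℂ` such that the universal
incoming Stokes factors together with their images decorate the diagram. -/
def IsSolution (s : D.prodIn ⟶ D.prodOut) : Prop :=
  D.IsDecoration (Limits.Pi.π fun γ : D.Cin => rootSubgroup J γ.1)
    (fun γ => s ≫ Limits.Pi.π (fun γ : D.Cout => rootSubgroup J γ.1) γ)

end ScatteringDiagram

end StokesScattering

end

/-! For a root `α` and a `ℂ`-algebra `R`, the `R`-points of `U_α` are exponentials of unique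
`R`-valued point derivations of weight `α` (`expPoint_injective`, `exists_expPoint_eq`). The claim
thus concerns ordered products of exponentials of given incoming derivations `x_γ` and unknown
outgoing derivations `y_γ`, over arbitrary `R`. Root spaces may have any finite dimension.

These exponentials are algebraic. Coadjoint operators act locally finitely on the coordinate ring,
and `xⁿ / n!` is an eigenfunctional of weight `n α`. A fixed function sees only finitely many of
these weights, so the exponential series is a finite sum on it
(`exists_forall_divPow_apply_eq_zero`).

To solve the equation by successive approximation, a grading is introduced formally. Let `M` be the
monoid generated by `Cin`, and replace each `x_γ` by `e^γ x_γ`, with coefficients in `R[M]`. The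
polarization gives a superadditive height on `M`, positive away from `0`. If the product is `1`
below height `n`, its part of weight `μ` and height `n` is a derivation of weight `μ`
(`component_mem_rootSpaceOver`). It vanishes unless `μ` is a root, and then `μ`, lying in `M`, is an
outgoing label. Changing `y_μ` changes this part additively, whatever the order of the factors
(`comp_gradedProduct_sub`), so each height has exactly one correction. Since `Cout` is finite, the
process terminates.

Setting every `e^μ` to `1` recovers the original equation. Nothing is lost, because eigenfunctionals
of distinct weights are independent (`eq_zero_of_augmentation_eq_zero`). Existence and uniqueness
hold on `S`-points for every `S`; applied to the universal incoming point they give the morphism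
`s`, and applied to `S = Spec ℂ` the statement on fixed decorations. -/

noncomputable section

namespace StokesScattering

open WithConv Coalgebra Polynomial

/-! ### Coadjoint operators and weights of functionals -/

section Operators

variable {A : Type} [CommRing A] [HopfAlgebra ℂ A] {R : Type} [CommRing R] [Algebra ℂ R]

/-- The operator `f ↦ φ(f₁) f₂`. -/
def leftContract (φ : ConvDual A) : A →ₗ[ℂ] A :=
  (TensorProduct.lid ℂ A).toLinearMap ∘ₗ φ.ofConv.rTensor A ∘ₗ comul

/-- The operator `f ↦ f₁ φ(f₂)`. -/
def rightContract (φ : ConvDual A) : A →ₗ[ℂ] A :=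
  (TensorProduct.rid ℂ A).toLinearMap ∘ₗ φ.ofConv.lTensor A ∘ₗ comul

/-- The coadjoint operator `f ↦ φ(f₁) f₂ - f₁ φ(f₂)`. -/
def coad (φ : ConvDual A) : A →ₗ[ℂ] A := leftContract φ - rightContract φ

variable (R) in
/-- Extension of scalars of a functional on `A`. -/
def extendScalars (φ : ConvDual A) : WithConv (A →ₗ[ℂ] R) :=
  toConv (Algebra.linearMap ℂ R ∘ₗ φ.ofConv)

theorem leftContract_repr (φ : ConvDual A) {f : A} {ι : Type*} (r : Coalgebra.Repr ℂ f ι) :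
    leftContract φ f = ∑ i ∈ r.index, φ (r.left i) • r.right i := by
  simp [leftContract, ← r.eq]

theorem rightContract_repr (φ : ConvDual A) {f : A} {ι : Type*} (r : Coalgebra.Repr ℂ f ι) :
    rightContract φ f = ∑ i ∈ r.index, φ (r.right i) • r.left i := by
  simp [rightContract, ← r.eq]

theorem extendScalars_mul_apply (φ : ConvDual A) (Y : WithConv (A →ₗ[ℂ] R)) (f : A) :
    (extendScalars R φ * Y) f = Y (leftContract φ f) := by
  rw [leftContract_repr φ (ℛ ℂ f), map_sum, (ℛ ℂ f).convMul_apply]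
  refine Finset.sum_congr rfl fun i _ => ?_
  rw [map_smul, Algebra.smul_def]
  rfl

theorem mul_extendScalars_apply (φ : ConvDual A) (Y : WithConv (A →ₗ[ℂ] R)) (f : A) :
    (Y * extendScalars R φ) f = Y (rightContract φ f) := by
  rw [rightContract_repr φ (ℛ ℂ f), map_sum, (ℛ ℂ f).convMul_apply]
  refine Finset.sum_congr rfl fun i _ => ?_
  rw [map_smul, Algebra.smul_def, mul_comm]
  rfl

theorem extendScalars_self (φ : ConvDual A) : extendScalars ℂ φ = φ := rfl

theorem ext_dual {a b : A} (h : ∀ ψ : ConvDual A, ψ a = ψ b) : a = b := by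
  rw [← sub_eq_zero, ← Module.forall_dual_apply_eq_zero_iff ℂ]
  intro ψ
  rw [map_sub, sub_eq_zero]
  exact h (toConv ψ)

/-- Contractions are transposes of convolution operators. Tested against all functionals, the
identities among them reduce to associativity of convolution. -/
theorem leftContract_leftContract (φ ψ : ConvDual A) (f : A) :
    leftContract φ (leftContract ψ f) = leftContract (ψ * φ) f := by
  refine ext_dual fun χ => ?_
  simp only [← extendScalars_mul_apply, extendScalars_self, mul_assoc]

theorem rightContract_rightContract (φ ψ : ConvDual A) (f : A) :
    rightContract φ (rightContract ψ f) = rightContract (φ * ψ) f := by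
  refine ext_dual fun χ => ?_
  simp only [← mul_extendScalars_apply, extendScalars_self, mul_assoc]

theorem rightContract_leftContract (φ ψ : ConvDual A) (f : A) :
    rightContract φ (leftContract ψ f) = leftContract ψ (rightContract φ f) := by
  refine ext_dual fun χ => ?_
  simp only [← mul_extendScalars_apply, ← extendScalars_mul_apply, extendScalars_self, mul_assoc]

theorem contract_one (f : A) : leftContract (1 : ConvDual A) (rightContract 1 f) = f := by
  refine ext_dual fun χ => ?_
  simp only [← mul_extendScalars_apply, ← extendScalars_mul_apply, extendScalars_self, one_mul,
    mul_one]

/-- The coadjoint operator is transposed to the commutator. Weights of `R`-valued functionals can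
therefore be tested by complex operators on `A`. -/
theorem apply_coad (φ : ConvDual A) (Y : WithConv (A →ₗ[ℂ] R)) (f : A) :
    Y (coad φ f) = (extendScalars R φ * Y - Y * extendScalars R φ) f := by
  rw [coad, LinearMap.sub_apply, map_sub, ofConv_sub, LinearMap.sub_apply,
    extendScalars_mul_apply, mul_extendScalars_apply]

/-- Precomposition with the coadjoint operator, a derivation of the convolution algebra. -/
def precompCoad (φ : ConvDual A) (Y : WithConv (A →ₗ[ℂ] R)) : WithConv (A →ₗ[ℂ] R) :=
  toConv (Y.ofConv ∘ₗ coad φ)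

theorem precompCoad_eq (φ : ConvDual A) (Y : WithConv (A →ₗ[ℂ] R)) :
    precompCoad φ Y = extendScalars R φ * Y - Y * extendScalars R φ := by
  ext f
  exact apply_coad φ Y f

theorem precompCoad_mul (φ : ConvDual A) (Y Z : WithConv (A →ₗ[ℂ] R)) :
    precompCoad φ (Y * Z) = precompCoad φ Y * Z + Y * precompCoad φ Z := by
  simp only [precompCoad_eq]
  noncomm_ring

/-- The coadjoint operators are locally finite. -/
theorem exists_finite_coad_invariant (f : A) : ∃ V : Submodule ℂ A, Module.Finite ℂ V ∧ f ∈ V ∧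
    ∀ φ : ConvDual A, ∀ v ∈ V, coad φ v ∈ V := by
  refine ⟨Submodule.span ℂ (Set.range fun p : ConvDual A × ConvDual A =>
    leftContract p.1 (rightContract p.2 f)), ?_,
    Submodule.subset_span ⟨(1, 1), contract_one f⟩, fun φ v hv => ?_⟩
  -- All two-sided contractions of `f` lie in the span `W` of the middle legs of one expansion of
  -- the iterated coproduct, which is finite-dimensional.
  · let r := ℛ ℂ f
    let W : Submodule ℂ A := ⨆ i ∈ r.index, Submodule.span ℂ
      ((fun j => (ℛ ℂ (r.left i)).right j) '' (ℛ ℂ (r.left i)).index)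
    have : Module.Finite ℂ W := by
      refine Module.Finite.iff_fg.2 (Submodule.fg_biSup _ _ fun i _ => ?_)
      exact Submodule.fg_span ((Finset.finite_toSet _).image _)
    refine Submodule.finiteDimensional_of_le (S₂ := W) (Submodule.span_le.2 ?_)
    rintro _ ⟨⟨φ, ψ⟩, rfl⟩
    simp only [rightContract_repr ψ r, map_sum, map_smul]
    refine Submodule.sum_mem _ fun i hi => Submodule.smul_mem _ _ ?_
    refine Submodule.mem_iSup_of_mem i (Submodule.mem_iSup_of_mem hi ?_)
    rw [leftContract_repr φ (ℛ ℂ (r.left i))]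
    exact Submodule.sum_mem _ fun j hj => Submodule.smul_mem _ _
      (Submodule.subset_span ⟨j, hj, rfl⟩)
  · induction hv using Submodule.span_induction with
    | mem x hx =>
      obtain ⟨⟨ψ, χ⟩, rfl⟩ := hx
      simp only [coad, LinearMap.sub_apply]
      rw [leftContract_leftContract, rightContract_leftContract, rightContract_rightContract]
      exact sub_mem (Submodule.subset_span ⟨(_, _), rfl⟩) (Submodule.subset_span ⟨(_, _), rfl⟩)
    | zero => simp
    | add x y _ _ hx hy => rw [map_add]; exact add_mem hx hy
    | smul c x _ hx => rw [map_smul]; exact Submodule.smul_mem _ _ hx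

/-- The iterates of `f` stay in a finite-dimensional space, so evaluation at `f` cannot be injective
on polynomials. -/
theorem exists_aeval_coad_eq_zero (φ : ConvDual A) (f : A) :
    ∃ p : ℂ[X], p ≠ 0 ∧ aeval (coad φ) p f = 0 := by
  obtain ⟨V, hV, hf, hφ⟩ := exists_finite_coad_invariant f
  have hpow : ∀ p : ℂ[X], aeval (coad φ) p f ∈ V := fun p => by
    induction p using Polynomial.induction_on' with
    | add p q hp hq => rw [map_add, LinearMap.add_apply]; exact add_mem hp hq
    | monomial n c =>
      rw [aeval_monomial]
      have : ∀ n, ((coad φ) ^ n) f ∈ V := fun n => by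
        induction n with
        | zero => simpa using hf
        | succ n ih => rw [pow_succ', Module.End.mul_apply]; exact hφ φ _ ih
      simpa [Algebra.smul_def, Module.algebraMap_end_apply] using V.smul_mem c (this n)
  let L : ℂ[X] →ₗ[ℂ] V := LinearMap.codRestrict V
    ((LinearMap.applyₗ f).comp (aeval (coad φ)).toLinearMap) hpow
  by_contra! hc
  have : Function.Injective L := by
    rw [← LinearMap.ker_eq_bot, LinearMap.ker_eq_bot']
    intro p hp
    by_contra h
    exact hc p h (congrArg Subtype.val hp)
  exact Polynomial.not_finite (Module.Finite.of_injective L this)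

theorem apply_aeval_coad {φ : ConvDual A} {c : ℂ} {Y : A →ₗ[ℂ] R}
    (hY : ∀ f, Y (coad φ f) = c • Y f) (p : ℂ[X]) (f : A) :
    Y (aeval (coad φ) p f) = p.eval c • Y f := by
  induction p using Polynomial.induction_on' with
  | add p q hp hq => rw [map_add, LinearMap.add_apply, map_add, hp, hq, eval_add, add_smul]
  | monomial n a =>
    have : ∀ n, Y (((coad φ) ^ n) f) = c ^ n • Y f := fun n => by
      induction n with
      | zero => simp
      | succ n ih => rw [pow_succ', Module.End.mul_apply, hY, ih, smul_smul, pow_succ']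
    rw [aeval_monomial, eval_monomial, Module.End.mul_apply, Module.algebraMap_end_apply,
      map_smul, this, smul_smul]

/-- Functionals of a large weight vanish at a given function. -/
theorem exists_forall_weight_apply_eq_zero (φ : ConvDual A) {c : ℂ} (hc : c ≠ 0) (f : A) :
    ∃ N : ℕ, ∀ n ≥ N, ∀ (R : Type) [CommRing R] [Algebra ℂ R] (Y : A →ₗ[ℂ] R),
      (∀ f, Y (coad φ f) = (n * c) • Y f) → Y f = 0 := by
  obtain ⟨p, hp, hpf⟩ := exists_aeval_coad_eq_zero φ f
  -- An eigenfunctional turns `p(coad φ) f = 0` into `p(n c) • Y f = 0`, and `c ≠ 0` makes `n c` a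
  -- root of `p` for only finitely many `n`.
  have hfin : {n : ℕ | p.eval ((n : ℂ) * c) = 0}.Finite := by
    refine Set.Finite.of_finite_image (f := fun n : ℕ => (n : ℂ) * c)
      ((Polynomial.finite_setOfPred_isRoot hp).subset ?_) ?_
    · rintro _ ⟨n, hn, rfl⟩
      exact hn
    · intro m _ n _ h
      exact_mod_cast mul_right_cancel₀ hc h
  obtain ⟨N, hN⟩ := hfin.bddAbove
  refine ⟨N + 1, fun n hn R _ _ Y hY => ?_⟩
  have h := apply_aeval_coad hY p f
  rw [hpf, map_zero] at h
  refine (smul_eq_zero.1 h.symm).resolve_left fun h0 => ?_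
  have := hN h0
  omega

/-- Extraction of the weight one component. -/
theorem exists_weight_one_projection (φ : ConvDual A) {c : ℂ} (hc : c ≠ 0) (f : A) :
    ∃ g : A, ∀ (n : ℕ) (R : Type) [CommRing R] [Algebra ℂ R] (Y : A →ₗ[ℂ] R),
      (∀ f, Y (coad φ f) = (n * c) • Y f) → Y g = if n = 1 then Y f else 0 := by
  obtain ⟨N, hN⟩ := exists_forall_weight_apply_eq_zero φ hc f
  -- Lagrange interpolation: `q` kills the weights `n c` with `n < N` other than `c`, while the
  -- weights with `n ≥ N` already vanish at `f`.
  let q : ℂ[X] := ∏ n ∈ (Finset.range N).erase 1, (X - C ((n : ℂ) * c))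
  have hq : q.eval c ≠ 0 := by
    rw [eval_prod, Finset.prod_ne_zero_iff]
    intro n hn
    have hn1 : (n : ℂ) ≠ 1 := by exact_mod_cast (Finset.mem_erase.1 hn).1
    rw [eval_sub, eval_X, eval_C, ← one_sub_mul]
    exact mul_ne_zero (sub_ne_zero.2 hn1.symm) hc
  refine ⟨(q.eval c)⁻¹ • aeval (coad φ) q f, fun n R _ _ Y hY => ?_⟩
  rw [map_smul, apply_aeval_coad hY]
  split_ifs with h
  · subst h
    rw [Nat.cast_one, one_mul, smul_smul, inv_mul_cancel₀ hq, one_smul]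
  · by_cases hn : n < N
    · have : q.eval ((n : ℂ) * c) = 0 := by
        rw [eval_prod]
        exact Finset.prod_eq_zero (Finset.mem_erase.2 ⟨h, Finset.mem_range.2 hn⟩) (by simp)
      rw [this, zero_smul, smul_zero]
    · rw [hN n (not_lt.1 hn) R Y hY, smul_zero, smul_zero]

end Operators

end StokesScattering

end

/-! ### Exponentials of derivations of nonzero weight -/

noncomputable section

namespace StokesScattering

open WithConv Coalgebra Polynomial

section Exponential

variable {A : Type} [CommRing A] [HopfAlgebra ℂ A] (J : Ideal A)
  (α : Module.Dual ℂ (cartan J)) (R : Type) [CommRing R] [Algebra ℂ R]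

/-- The root space over `R`: the `R`-valued point derivations of weight `α`. -/
def rootSpaceOver : Submodule R (WithConv (A →ₗ[ℂ] R)) where
  carrier := {x | (∀ a b : A, x (a * b) = counit (R := ℂ) a • x b + counit (R := ℂ) b • x a) ∧
    ∀ (H : cartan J) (f : A), x (coad (H : ConvDual A) f) = α H • x f}
  add_mem' := fun {x y} hx hy =>
    ⟨fun a b => by
      simp only [ofConv_add, LinearMap.add_apply, hx.1, hy.1, smul_add]; abel,
    fun H f => by simp only [ofConv_add, LinearMap.add_apply, hx.2, hy.2, smul_add]⟩
  zero_mem' := ⟨fun a b => by simp, fun H f => by simp⟩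
  smul_mem' := fun r x hx =>
    ⟨fun a b => by
      simp only [ofConv_smul, LinearMap.smul_apply, hx.1, smul_add, smul_comm r],
    fun H f => by simp only [ofConv_smul, LinearMap.smul_apply, hx.2, smul_comm r]⟩

variable {J α R}

theorem mem_rootSpace_iff {X : ConvDual A} : X ∈ rootSpace J α ↔ X ∈ rootSpaceOver J α ℂ := by
  refine and_congr (forall_congr' fun a => forall_congr' fun b => ?_)
    (forall_congr' fun H => ?_)
  · rw [smul_eq_mul, smul_eq_mul, mul_comm (counit b)]
  · rw [Ring.lie_def, WithConv.ext_iff, LinearMap.ext_iff]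
    refine forall_congr' fun f => ?_
    rw [apply_coad, extendScalars_self]
    rfl

theorem apply_one_of_mem_rootSpaceOver {x : WithConv (A →ₗ[ℂ] R)} (hx : x ∈ rootSpaceOver J α R) :
    x 1 = 0 := by
  have h := hx.1 1 1
  rw [mul_one, Bialgebra.counit_one, one_smul] at h
  exact left_eq_add.1 h

/-- Precomposition with `coad H` is an inner derivation of the convolution algebra, so weights add
under convolution. -/
theorem pow_apply_coad {x : WithConv (A →ₗ[ℂ] R)} (hx : x ∈ rootSpaceOver J α R) (n : ℕ)
    (H : cartan J) (f : A) : (x ^ n) (coad (H : ConvDual A) f) = (n * α H) • (x ^ n) f := by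
  have h1 : precompCoad (H : ConvDual A) x = α H • x := by
    ext f
    exact hx.2 H f
  have h : precompCoad (H : ConvDual A) (x ^ n) = (n * α H) • x ^ n := by
    induction n with
    | zero => simp [precompCoad_eq]
    | succ n ih =>
      rw [pow_succ, precompCoad_mul, ih, h1, smul_mul_assoc, mul_smul_comm, ← add_smul]
      push_cast
      ring_nf
  exact congrArg (fun Y : WithConv (A →ₗ[ℂ] R) => Y f) h

theorem exists_apply_ne_zero (hα : α ≠ 0) : ∃ H : cartan J, α H ≠ 0 := by
  by_contra! h
  exact hα (LinearMap.ext h)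

/-- The divided power `xⁿ / n!` in the convolution algebra. -/
def divPow (x : WithConv (A →ₗ[ℂ] R)) (n : ℕ) : WithConv (A →ₗ[ℂ] R) :=
  (n.factorial : ℂ)⁻¹ • x ^ n

theorem divPow_zero (x : WithConv (A →ₗ[ℂ] R)) : divPow x 0 = 1 := by simp [divPow]

theorem divPow_one (x : WithConv (A →ₗ[ℂ] R)) : divPow x 1 = x := by simp [divPow]

theorem mul_divPow (x : WithConv (A →ₗ[ℂ] R)) (n : ℕ) :
    x * divPow x n = ((n : ℂ) + 1) • divPow x (n + 1) := by
  have h : (n : ℂ) + 1 ≠ 0 := by exact_mod_cast n.succ_ne_zero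
  rw [divPow, divPow, mul_smul_comm, smul_smul, Nat.factorial_succ, Nat.cast_mul, Nat.cast_succ,
    mul_inv, mul_inv_cancel_left₀ h, pow_succ']

theorem divPow_apply_coad {x : WithConv (A →ₗ[ℂ] R)} (hx : x ∈ rootSpaceOver J α R) (n : ℕ)
    (H : cartan J) (f : A) :
    divPow x n (coad (H : ConvDual A) f) = (n * α H) • divPow x n f := by
  simp only [divPow, ofConv_smul, LinearMap.smul_apply, pow_apply_coad hx, smul_comm (_ : ℂ)⁻¹]

/-- Some `H` has `α H ≠ 0`, so the weights `n α H` are distinct and the large ones vanish at `f`.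
The bound depends only on `f`, not on `x` or `R`. -/
theorem exists_forall_divPow_apply_eq_zero (hα : α ≠ 0) (f : A) :
    ∃ N : ℕ, ∀ n ≥ N, ∀ (R : Type) [CommRing R] [Algebra ℂ R],
      ∀ x ∈ rootSpaceOver J α R, divPow x n f = 0 := by
  obtain ⟨H, hH⟩ := exists_apply_ne_zero hα
  obtain ⟨N, hN⟩ := exists_forall_weight_apply_eq_zero (H : ConvDual A) hH f
  exact ⟨N, fun n hn R _ _ x hx => hN n hn R _ (divPow_apply_coad hx n H)⟩

theorem counit_tensor_aux {a : A} (Y : WithConv (A →ₗ[ℂ] R)) :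
    ∑ i ∈ (ℛ ℂ a).index, counit (R := ℂ) ((ℛ ℂ a).left i) • Y ((ℛ ℂ a).right i) = Y a := by
  conv_rhs => rw [← one_mul Y, (ℛ ℂ a).convMul_apply]
  refine Finset.sum_congr rfl fun i _ => ?_
  rw [Algebra.smul_def]
  rfl

/-- Dually, `x` is primitive, with coproduct `x ⊗ ε + ε ⊗ x`. Multiplying this into the coproduct `∑
U k ⊗ V k` of `Y` gives the two families of terms. -/
theorem derivation_mul_apply_mul {x : WithConv (A →ₗ[ℂ] R)} (hx : x ∈ rootSpaceOver J α R)
    {ι : Type*} {s : Finset ι} {Y : WithConv (A →ₗ[ℂ] R)} {U V : ι → WithConv (A →ₗ[ℂ] R)}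
    (hY : ∀ a b, Y (a * b) = ∑ k ∈ s, U k a * V k b) (a b : A) :
    (x * Y) (a * b) = ∑ k ∈ s, (U k a * (x * V k) b + (x * U k) a * V k b) := by
  have h : ∀ k i j, (x ((ℛ ℂ a).left i * (ℛ ℂ b).left j)) *
      (U k ((ℛ ℂ a).right i) * V k ((ℛ ℂ b).right j)) =
      (counit (R := ℂ) ((ℛ ℂ a).left i) • U k ((ℛ ℂ a).right i)) *
        (x ((ℛ ℂ b).left j) * V k ((ℛ ℂ b).right j)) +
      (x ((ℛ ℂ a).left i) * U k ((ℛ ℂ a).right i)) *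
        (counit (R := ℂ) ((ℛ ℂ b).left j) • V k ((ℛ ℂ b).right j)) := fun k i j => by
    rw [hx.1]
    simp only [Algebra.smul_def]
    ring
  rw [((ℛ ℂ a).mul (ℛ ℂ b)).convMul_apply, Coalgebra.Repr.mul_index, Finset.sum_product]
  simp only [Coalgebra.Repr.mul_left, Coalgebra.Repr.mul_right, hY, Finset.mul_sum, h,
    Finset.sum_add_distrib]
  rw [Finset.sum_congr rfl fun i _ => Finset.sum_comm, Finset.sum_comm,
    Finset.sum_congr (s₁ := (ℛ ℂ a).index) rfl fun i _ => Finset.sum_comm,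
    Finset.sum_comm (s := (ℛ ℂ a).index)]
  simp only [← Finset.mul_sum, ← Finset.sum_mul, counit_tensor_aux, (ℛ ℂ a).convMul_apply,
    (ℛ ℂ b).convMul_apply]

/-- This is the Cauchy product rule for coefficients of `exp (t x)`, hence what makes the
exponential an algebra map. -/
theorem divPow_apply_mul {x : WithConv (A →ₗ[ℂ] R)} (hx : x ∈ rootSpaceOver J α R) (n : ℕ)
    (a b : A) : divPow x n (a * b) =
      ∑ p ∈ Finset.HasAntidiagonal.antidiagonal n, divPow x p.1 a * divPow x p.2 b := by
  induction n generalizing a b with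
  | zero => simp [divPow_zero]
  | succ n ih =>
    have hn : (n : ℂ) + 1 ≠ 0 := by exact_mod_cast n.succ_ne_zero
    have h := derivation_mul_apply_mul hx ih a b
    simp only [mul_divPow, ofConv_smul, LinearMap.smul_apply, mul_smul_comm, smul_mul_assoc] at h
    refine smul_right_injective _ hn (h.trans ?_)
    dsimp only
    -- The factor `n + 1 = p.2 + p.1` is split so that each half matches one family of Leibniz
    -- terms; the boundary terms carry coefficient `0`.
    have h2 : ((n : ℂ) + 1) • ∑ p ∈ Finset.HasAntidiagonal.antidiagonal (n + 1), divPow x p.1 a * divPow x p.2 b =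
        ∑ p ∈ Finset.HasAntidiagonal.antidiagonal (n + 1), (p.2 : ℂ) • (divPow x p.1 a * divPow x p.2 b) +
        ∑ p ∈ Finset.HasAntidiagonal.antidiagonal (n + 1), (p.1 : ℂ) • (divPow x p.1 a * divPow x p.2 b) := by
      rw [Finset.smul_sum, ← Finset.sum_add_distrib]
      refine Finset.sum_congr rfl fun p hp => ?_
      rw [← add_smul, ← Nat.cast_add, add_comm p.2, Finset.HasAntidiagonal.mem_antidiagonal.1 hp, Nat.cast_succ]
    rw [h2, Finset.Nat.sum_antidiagonal_succ', Finset.Nat.sum_antidiagonal_succ,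
      Finset.sum_add_distrib]
    simp

theorem divPow_succ_apply_one {x : WithConv (A →ₗ[ℂ] R)} (hx : x ∈ rootSpaceOver J α R) (n : ℕ) :
    divPow x (n + 1) (1 : A) = 0 := by
  rw [divPow, pow_succ', ofConv_smul, LinearMap.smul_apply, LinearMap.convMul_apply,
    Bialgebra.comul_one, Algebra.TensorProduct.one_def, TensorProduct.map_tmul,
    LinearMap.mul'_apply, apply_one_of_mem_rootSpaceOver hx, zero_mul, smul_zero]

/-- The exponential of `t x`, with a formal parameter `t`, of a derivation `x` of nonzero
weight. -/
def expPoly (hα : α ≠ 0) (x : rootSpaceOver J α R) : A →ₐ[ℂ] R[X] :=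
  have key : ∀ f : A, ∃ p : R[X], ∀ n, p.coeff n = divPow x.1 n f := fun f => by
    obtain ⟨N, hN⟩ := exists_forall_divPow_apply_eq_zero hα f
    refine ⟨∑ n ∈ Finset.range N, monomial n (divPow x.1 n f), fun n => ?_⟩
    simp only [finsetSum_coeff, coeff_monomial, Finset.sum_ite_eq', Finset.mem_range]
    split_ifs with h
    · rfl
    · exact (hN n (not_lt.1 h) R x.1 x.2).symm
  AlgHom.ofLinearMap
    { toFun := fun f => (key f).choose
      map_add' := fun f g => Polynomial.ext fun n => by
        rw [coeff_add, (key f).choose_spec, (key g).choose_spec, (key (f + g)).choose_spec, map_add]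
      map_smul' := fun c f => Polynomial.ext fun n => by
        rw [coeff_smul, (key f).choose_spec, (key (c • f)).choose_spec, map_smul,
          RingHom.id_apply] }
    (Polynomial.ext fun n => ((key 1).choose_spec n).trans (by
      cases n with
      | zero => simp [divPow_zero]
      | succ n => rw [divPow_succ_apply_one x.2, coeff_one, if_neg n.succ_ne_zero]))
    (fun f g => Polynomial.ext fun n => ((key (f * g)).choose_spec n).trans (by
      rw [coeff_mul, divPow_apply_mul x.2]
      exact Finset.sum_congr rfl fun p _ => by
        rw [← (key f).choose_spec, ← (key g).choose_spec]; rfl))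

theorem coeff_expPoly (hα : α ≠ 0) (x : rootSpaceOver J α R) (f : A) (n : ℕ) :
    (expPoly hα x f).coeff n = divPow x.1 n f := by
  rw [expPoly, AlgHom.ofLinearMap_apply]
  exact Exists.choose_spec (p := fun p : R[X] => ∀ n, p.coeff n = divPow x.1 n f) _ n

end Exponential

end StokesScattering

end

/-! ### The weight-graded coefficient ring and its height filtration -/

noncomputable section

namespace StokesScattering

open WithConv Coalgebra Polynomial

section Graded

variable {A : Type} [CommRing A] [HopfAlgebra ℂ A] {J : Ideal A}
  {R : Type} [CommRing R] {M : AddSubmonoid (Module.Dual ℂ (cartan J))}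

/-- The monoid algebra `R[M]` of a monoid `M` of weights. -/
def WeightRing (R : Type) [CommRing R] (M : AddSubmonoid (Module.Dual ℂ (cartan J))) : Type :=
  AddMonoidAlgebra R M

namespace WeightRing

instance : CommRing (WeightRing R M) := inferInstanceAs (CommRing (AddMonoidAlgebra R M))

/-- The element `r e^μ`. -/
def single (μ : M) (r : R) : WeightRing R M := AddMonoidAlgebra.single μ r

theorem single_zero (μ : M) : single μ (0 : R) = 0 := AddMonoidAlgebra.single_zero μ

theorem single_mul_single (μ ν : M) (r s : R) :
    single μ r * single ν s = single (μ + ν) (r * s) := AddMonoidAlgebra.single_mul_single ..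

theorem induction {motive : WeightRing R M → Prop} (p : WeightRing R M) (zero : motive 0)
    (add : ∀ p q, motive p → motive q → motive (p + q))
    (single : ∀ μ r, motive (single μ r)) : motive p :=
  AddMonoidAlgebra.induction_linear (motive := motive) p zero add single

variable [Algebra ℂ R]

instance : Algebra ℂ (WeightRing R M) := inferInstanceAs (Algebra ℂ (AddMonoidAlgebra R M))

/-- The component of weight `μ`. -/
def comp (μ : M) : WeightRing R M →ₗ[ℂ] R where
  toFun p := AddMonoidAlgebra.coeff p μ
  map_add' _ _ := rfl
  map_smul' _ _ := rfl

@[ext]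
theorem ext {p q : WeightRing R M} (h : ∀ μ, comp μ p = comp μ q) : p = q :=
  AddMonoidAlgebra.coeff_injective (Finsupp.ext h)

theorem comp_single_self (μ : M) (r : R) : comp μ (single μ r) = r := Finsupp.single_eq_same

theorem comp_single_of_ne {μ ν : M} (h : μ ≠ ν) (r : R) : comp ν (single μ r) = 0 :=
  Finsupp.single_eq_of_ne h.symm

theorem algebraMap_eq (c : ℂ) :
    algebraMap ℂ (WeightRing R M) c = single 0 (algebraMap ℂ R c) := rfl

theorem exists_finset_comp_eq_zero (p : WeightRing R M) :
    ∃ s : Finset M, ∀ μ ∉ s, comp μ p = 0 :=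
  ⟨(AddMonoidAlgebra.coeff p).support, fun _ hμ => Finsupp.notMem_support_iff.1 hμ⟩

theorem comp_mul_eq_zero {p q : WeightRing R M} {μ : M}
    (h : ∀ κ ν, κ + ν = μ → comp κ p = 0 ∨ comp ν q = 0) : comp μ (p * q) = 0 := by
  classical
  refine (AddMonoidAlgebra.coeff_mul (R := R) p q μ).trans ?_
  refine Finset.sum_eq_zero fun a _ => Finset.sum_eq_zero fun b _ => ?_
  dsimp only
  split_ifs with hab
  · rcases h a b hab with h | h
    · exact mul_eq_zero_of_left h _
    · exact mul_eq_zero_of_right _ h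
  · rfl

variable (R M) in
/-- The derivation of `R[M]` multiplying the component of weight `μ` by `μ(H)`. -/
def weightOp (H : cartan J) : WeightRing R M →ₗ[ℂ] WeightRing R M where
  toFun p := AddMonoidAlgebra.ofCoeff (Finsupp.onFinset (AddMonoidAlgebra.coeff p).support
    (fun μ => μ.1 H • AddMonoidAlgebra.coeff p μ)
    fun μ h => Finsupp.mem_support_iff.2 fun h0 => h (by rw [h0, smul_zero]))
  map_add' p q := AddMonoidAlgebra.coeff_injective (Finsupp.ext fun μ => smul_add _ _ _)
  map_smul' c p := AddMonoidAlgebra.coeff_injective (Finsupp.ext fun μ => smul_comm _ _ _)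

theorem comp_weightOp (H : cartan J) (p : WeightRing R M) (μ : M) :
    comp μ (weightOp R M H p) = μ.1 H • comp μ p := rfl

theorem weightOp_single (H : cartan J) (μ : M) (r : R) :
    weightOp R M H (single μ r) = μ.1 H • single μ r := by
  ext ν
  rw [comp_weightOp, map_smul]
  by_cases h : μ = ν
  · rw [h]
  · rw [comp_single_of_ne h, smul_zero, smul_zero]

theorem weightOp_mul (H : cartan J) (p q : WeightRing R M) :
    weightOp R M H (p * q) = weightOp R M H p * q + p * weightOp R M H q := by
  induction p using WeightRing.induction with
  | zero => simp
  | add p p' hp hp' => rw [add_mul, map_add, hp, hp', map_add]; ring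
  | single μ r =>
    induction q using WeightRing.induction with
    | zero => simp
    | add q q' hq hq' => rw [mul_add, map_add, hq, hq', map_add]; ring
    | single ν s =>
      rw [single_mul_single, weightOp_single, weightOp_single, weightOp_single,
        smul_mul_assoc, mul_smul_comm, single_mul_single, ← add_smul]
      rfl

variable (R M) in
/-- Sum of all components. -/
def augmentation : WeightRing R M →ₐ[ℂ] R :=
  show AddMonoidAlgebra R M →ₐ[ℂ] R from (AddMonoidAlgebra.lift R R M 1).restrictScalars ℂ

theorem augmentation_single (μ : M) (r : R) : augmentation R M (single μ r) = r := by
  refine (AddMonoidAlgebra.lift_single _ _ _).trans ?_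
  simp

variable (R) in
/-- The substitution `t ↦ e^μ`. -/
def substitute (μ : M) : R[X] →ₐ[ℂ] WeightRing R M :=
  show R[X] →ₐ[ℂ] AddMonoidAlgebra R M from
    (aeval (AddMonoidAlgebra.single μ (1 : R))).restrictScalars ℂ

theorem substitute_monomial (μ : M) (n : ℕ) (r : R) :
    substitute R μ (monomial n r) = single (n • μ) r := by
  change aeval (AddMonoidAlgebra.single μ (1 : R)) (monomial n r) = AddMonoidAlgebra.single _ r
  rw [aeval_monomial, AddMonoidAlgebra.single_pow, ← Algebra.smul_def, AddMonoidAlgebra.smul_single,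
    one_pow, smul_eq_mul, mul_one]

end WeightRing

open WeightRing

variable [Algebra ℂ R]

theorem postcomp_mul {S : Type} [CommRing S] [Algebra ℂ S] {d : S →ₗ[ℂ] S}
    (hd : ∀ p q, d (p * q) = d p * q + p * d q) (Y Z : WithConv (A →ₗ[ℂ] S)) :
    toConv (d ∘ₗ (Y * Z).ofConv) = toConv (d ∘ₗ Y.ofConv) * Z + Y * toConv (d ∘ₗ Z.ofConv) := by
  ext f
  change d ((Y * Z) f) = (toConv (d ∘ₗ Y.ofConv) * Z) f + (Y * toConv (d ∘ₗ Z.ofConv)) f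
  rw [(ℛ ℂ f).convMul_apply, (ℛ ℂ f).convMul_apply, (ℛ ℂ f).convMul_apply, map_sum,
    ← Finset.sum_add_distrib]
  exact Finset.sum_congr rfl fun i _ => hd _ _

/-- The failure of a functional to respect weights, a derivation of the convolution algebra. -/
def weightDefect (H : cartan J) (Y : WithConv (A →ₗ[ℂ] WeightRing R M)) :
    WithConv (A →ₗ[ℂ] WeightRing R M) :=
  precompCoad (H : ConvDual A) Y - toConv (weightOp R M H ∘ₗ Y.ofConv)

/-- A difference of two derivations is a derivation. Consequently the functionals respecting weights
are closed under convolution. -/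
theorem weightDefect_mul (H : cartan J) (Y Z : WithConv (A →ₗ[ℂ] WeightRing R M)) :
    weightDefect H (Y * Z) = weightDefect H Y * Z + Y * weightDefect H Z := by
  have h := postcomp_mul (weightOp_mul (R := R) (M := M) H) Y Z
  rw [weightDefect, precompCoad_mul, h, weightDefect, weightDefect, sub_mul, mul_sub]
  abel

theorem weightDefect_one (H : cartan J) :
    weightDefect H (1 : WithConv (A →ₗ[ℂ] WeightRing R M)) = 0 := by
  have h := weightDefect_mul H (1 : WithConv (A →ₗ[ℂ] WeightRing R M)) 1
  rw [mul_one, one_mul, mul_one] at h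
  exact left_eq_add.1 h

theorem weightDefect_eq_zero_iff {H : cartan J} {Y : WithConv (A →ₗ[ℂ] WeightRing R M)} :
    weightDefect H Y = 0 ↔ ∀ f, Y (coad (H : ConvDual A) f) = weightOp R M H (Y f) := by
  rw [weightDefect, sub_eq_zero, WithConv.ext_iff, LinearMap.ext_iff]
  rfl

theorem weightDefect_of_mul_eq_one {H : cartan J}
    {Y Z : WithConv (A →ₗ[ℂ] WeightRing R M)} (hZY : Z * Y = 1) (hYZ : Y * Z = 1)
    (hY : weightDefect H Y = 0) : weightDefect H Z = 0 := by
  have h := weightDefect_mul H Z Y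
  rw [hZY, weightDefect_one, hY, mul_zero, add_zero] at h
  rw [← mul_one (weightDefect H Z), ← hYZ, ← mul_assoc, ← h, zero_mul]

/-- The components of different weights are independent. -/
theorem eq_zero_of_augmentation_eq_zero {Y : WithConv (A →ₗ[ℂ] WeightRing R M)}
    (hY : ∀ H : cartan J, weightDefect H Y = 0) (h0 : ∀ f, augmentation R M (Y f) = 0) :
    Y = 0 := by
  classical
  have key : ∀ (s : Finset M) (f : A), (∀ μ ∉ s, comp μ (Y f) = 0) → Y f = 0 := fun s => by
    induction s using Finset.induction_on with
    | empty => exact fun f hf => WeightRing.ext fun μ => (hf μ (by simp)).trans (map_zero _).symm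
    | insert ν s hν ih =>
      intro f hf
      have h1 : ∀ μ, μ ≠ ν → comp μ (Y f) = 0 := fun μ hμ => by
        obtain ⟨H, hH⟩ : ∃ H, μ.1 H ≠ ν.1 H := by
          by_contra! hc
          exact hμ (Subtype.ext (LinearMap.ext hc))
        -- Replacing `f` by `coad H f - ν(H) f` removes the component `ν` and rescales the others,
        -- so the induction hypothesis applies; `H` is chosen to make the factor at `μ` nonzero.
        have hg : ∀ κ, comp κ (Y (coad (H : ConvDual A) f - ν.1 H • f)) =
            (κ.1 H - ν.1 H) • comp κ (Y f) := fun κ => by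
          rw [map_sub, map_smul, weightDefect_eq_zero_iff.1 (hY H), sub_smul, map_sub, map_smul,
            comp_weightOp]
        have h2 := hg μ
        rw [ih _ fun κ hκ => ?_, map_zero] at h2
        · exact (smul_eq_zero.1 h2.symm).resolve_left (sub_ne_zero.2 hH)
        · rw [hg]
          by_cases h : κ = ν
          · rw [h, sub_self, zero_smul]
          · rw [hf κ (by simp [h, hκ]), smul_zero]
      have h2 : Y f = single ν (comp ν (Y f)) := by
        ext μ
        by_cases h : ν = μ
        · rw [← h, comp_single_self]
        · rw [comp_single_of_ne h, h1 μ (Ne.symm h)]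
      have h3 := h0 f
      rw [h2, augmentation_single] at h3
      rw [h2, h3, single_zero]
  ext f : 2
  obtain ⟨s, hs⟩ := exists_finset_comp_eq_zero (Y f)
  exact key s f hs

/-- A superadditive function on `M`, positive away from the origin. -/
structure IsHeight (h : M → ℕ) : Prop where
  add_le : ∀ μ ν, h μ + h ν ≤ h (μ + ν)
  pos : ∀ μ, μ ≠ 0 → 0 < h μ

theorem IsHeight.map_zero {h : M → ℕ} (hh : IsHeight h) : h 0 = 0 := by
  have := hh.add_le 0 0
  rw [add_zero] at this
  omega

/-- Finiteness of `C` bounds `l` below by some `c > 0` on `C`, hence on all nonzero elements of the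
monoid. The integer part of `l / c` is then superadditive and at least `1` off the origin. -/
theorem exists_isHeight {C : Set (Module.Dual ℂ (cartan J))} (hC : C.Finite)
    (l : Module.Dual ℂ (cartan J) →ₗ[ℝ] ℝ) (hl : ∀ γ ∈ C, 0 < l γ) :
    ∃ h : AddSubmonoid.closure C → ℕ, IsHeight h := by
  obtain ⟨c, hc, hcl⟩ : ∃ c : ℝ, 0 < c ∧ ∀ γ ∈ C, c ≤ l γ := by
    rcases C.eq_empty_or_nonempty with rfl | hne
    · exact ⟨1, one_pos, by simp⟩
    · obtain ⟨γ, hγ, hmin⟩ := Set.exists_min_image C l hC hne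
      exact ⟨l γ, hl γ hγ, hmin⟩
  have key : ∀ μ ∈ AddSubmonoid.closure C, μ = 0 ∨ c ≤ l μ := fun μ hμ => by
    induction hμ using AddSubmonoid.closure_induction with
    | mem x hx => exact Or.inr (hcl x hx)
    | zero => exact Or.inl rfl
    | add x y _ _ hx hy =>
      rcases hx with rfl | hx
      · rwa [zero_add]
      · rcases hy with rfl | hy
        · rw [add_zero]; exact Or.inr hx
        · rw [map_add]; exact Or.inr (by linarith)
  have nonneg : ∀ μ : AddSubmonoid.closure C, 0 ≤ l μ.1 / c := fun μ => by
    rcases key μ.1 μ.2 with h | h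
    · rw [h, map_zero, zero_div]
    · exact div_nonneg (hc.le.trans h) hc.le
  refine ⟨fun μ => ⌊l μ.1 / c⌋₊, fun μ ν => ?_, fun μ hμ => ?_⟩
  · refine Nat.le_floor ?_
    rw [AddSubmonoid.coe_add, map_add, add_div, Nat.cast_add]
    exact add_le_add (Nat.floor_le (nonneg μ)) (Nat.floor_le (nonneg ν))
  · refine Nat.floor_pos.2 ((one_le_div hc).2 ?_)
    exact (key μ.1 μ.2).resolve_left fun h => hμ (Subtype.ext h)

variable {h : M → ℕ}

variable (R) in
/-- The elements of `R[M]` without components of height less than `n`. -/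
def heightFiltration (h : M → ℕ) (n : ℕ) : AddSubgroup (WeightRing R M) where
  carrier := {p | ∀ μ, h μ < n → comp μ p = 0}
  add_mem' := fun {p q} hp hq μ hμ => by rw [map_add, hp μ hμ, hq μ hμ, add_zero]
  zero_mem' := fun _ _ => map_zero _
  neg_mem' := fun {p} hp μ hμ => by rw [map_neg, hp μ hμ, neg_zero]

theorem heightFiltration_mono {m n : ℕ} (hmn : m ≤ n) {p : WeightRing R M}
    (hp : p ∈ heightFiltration R h n) : p ∈ heightFiltration R h m :=
  fun μ hμ => hp μ (hμ.trans_le hmn)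

theorem mul_mem_heightFiltration (hh : IsHeight h) {m n : ℕ} {p q : WeightRing R M}
    (hp : p ∈ heightFiltration R h m) (hq : q ∈ heightFiltration R h n) :
    p * q ∈ heightFiltration R h (m + n) := fun μ hμ => comp_mul_eq_zero fun κ ν hκν => by
  have := hh.add_le κ ν
  rw [hκν] at this
  rcases lt_or_ge (h κ) m with hκ | hκ
  · exact Or.inl (hp κ hκ)
  · exact Or.inr (hq ν (by omega))

variable (A R) in
/-- The functionals with values of height at least `n`. -/
def convFiltration (h : M → ℕ) (n : ℕ) : AddSubgroup (WithConv (A →ₗ[ℂ] WeightRing R M)) where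
  carrier := {Y | ∀ f, Y f ∈ heightFiltration R h n}
  add_mem' := fun hY hZ f => add_mem (hY f) (hZ f)
  zero_mem' := fun _ => zero_mem _
  neg_mem' := fun hY f => neg_mem (hY f)

theorem convFiltration_mono {m n : ℕ} (hmn : m ≤ n) {Y : WithConv (A →ₗ[ℂ] WeightRing R M)}
    (hY : Y ∈ convFiltration A R h n) : Y ∈ convFiltration A R h m :=
  fun f => heightFiltration_mono hmn (hY f)

theorem mem_convFiltration_zero (Y : WithConv (A →ₗ[ℂ] WeightRing R M)) :
    Y ∈ convFiltration A R h 0 := fun _ _ hμ => absurd hμ (Nat.not_lt_zero _)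

theorem mul_mem_convFiltration (hh : IsHeight h) {m n : ℕ}
    {Y Z : WithConv (A →ₗ[ℂ] WeightRing R M)} (hY : Y ∈ convFiltration A R h m)
    (hZ : Z ∈ convFiltration A R h n) : Y * Z ∈ convFiltration A R h (m + n) := fun f => by
  rw [(ℛ ℂ f).convMul_apply]
  exact sum_mem fun i _ => mul_mem_heightFiltration hh (hY _) (hZ _)

theorem eq_zero_of_forall_mem_convFiltration {Y : WithConv (A →ₗ[ℂ] WeightRing R M)}
    (hY : ∀ n, Y ∈ convFiltration A R h n) : Y = 0 := by
  ext f : 2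
  exact WeightRing.ext fun μ => (hY (h μ + 1) f μ (Nat.lt_succ_self _)).trans (map_zero _).symm

theorem list_prod_sub_one_mem (hh : IsHeight h) {ι : Type*} (l : List ι)
    {a : ι → WithConv (A →ₗ[ℂ] WeightRing R M)}
    (ha : ∀ i, a i - 1 ∈ convFiltration A R h 1) :
    (l.map a).prod - 1 ∈ convFiltration A R h 1 := by
  induction l with
  | nil => simp [zero_mem]
  | cons i l ih =>
    have h1 : ((i :: l).map a).prod - 1 = a i * ((l.map a).prod - 1) + (a i - 1) := by
      rw [List.map_cons, List.prod_cons, mul_sub, mul_one, sub_add_sub_cancel]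
    have h2 := mul_mem_convFiltration hh (mem_convFiltration_zero (h := h) (a i)) ih
    rw [zero_add] at h2
    rw [h1]
    exact add_mem h2 (ha i)

/-- A perturbation of the factors of a product in degrees at least `n` changes its part of degree
`n` by the sum of the perturbations. -/
theorem list_prod_perturbation (hh : IsHeight h) {ι : Type*} (l : List ι) {n : ℕ} (hn : 1 ≤ n)
    {a b : ι → WithConv (A →ₗ[ℂ] WeightRing R M)}
    (ha : ∀ i, a i - 1 ∈ convFiltration A R h 1)
    (hab : ∀ i, b i - a i ∈ convFiltration A R h n) :
    (l.map b).prod - (l.map a).prod - (l.map fun i => b i - a i).sum ∈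
      convFiltration A R h (n + 1) := by
  have hb : ∀ i, b i - 1 ∈ convFiltration A R h 1 := fun i => by
    have := add_mem (convFiltration_mono hn (hab i)) (ha i)
    rwa [sub_add_sub_cancel] at this
  induction l with
  | nil => simp [zero_mem]
  | cons i l ih =>
    have hs : (l.map fun i => b i - a i).sum ∈ convFiltration A R h n :=
      AddSubgroup.list_sum_mem _ fun x hx => by
        obtain ⟨i, -, rfl⟩ := List.mem_map.1 hx
        exact hab i
    -- The first summand is covered by induction; each of the other two pairs a factor of degree `n`
    -- with one of degree `1`.
    have e : ((i :: l).map b).prod - ((i :: l).map a).prod -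
        ((i :: l).map fun i => b i - a i).sum =
        a i * ((l.map b).prod - (l.map a).prod - (l.map fun i => b i - a i).sum) +
        (a i - 1) * (l.map fun i => b i - a i).sum +
        (b i - a i) * ((l.map b).prod - 1) := by
      simp only [List.map_cons, List.prod_cons, List.sum_cons, mul_sub, sub_mul, mul_one, one_mul]
      abel
    rw [e]
    refine add_mem (add_mem ?_ ?_) ?_
    · simpa using mul_mem_convFiltration hh (mem_convFiltration_zero (h := h) (a i)) ih
    · simpa [add_comm] using mul_mem_convFiltration hh (ha i) hs
    · exact mul_mem_convFiltration hh (hab i) (list_prod_sub_one_mem hh l hb)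

/-- The component of weight `μ` of a functional. -/
def component (μ : M) (Y : WithConv (A →ₗ[ℂ] WeightRing R M)) : WithConv (A →ₗ[ℂ] R) :=
  toConv (comp μ ∘ₗ Y.ofConv)

theorem component_apply (μ : M) (Y : WithConv (A →ₗ[ℂ] WeightRing R M)) (f : A) :
    component μ Y f = comp μ (Y f) := rfl

theorem comp_algebraMap {μ : M} (hμ : μ ≠ 0) (c : ℂ) :
    comp μ (algebraMap ℂ (WeightRing R M) c) = 0 := by
  rw [WeightRing.algebraMap_eq, comp_single_of_ne hμ.symm]

/-- The leading part of an `R[M]`-valued point is a derivation. -/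
theorem component_mem_rootSpaceOver (hh : IsHeight h) (g : A →ₐ[ℂ] WeightRing R M)
    (hg : ∀ H : cartan J, weightDefect H (toConv g.toLinearMap) = 0) {μ : M} (hμ : μ ≠ 0)
    (hgn : toConv g.toLinearMap - 1 ∈ convFiltration A R h (h μ)) :
    component μ (toConv g.toLinearMap) ∈ rootSpaceOver J μ.1 R := by
  refine ⟨fun a b => ?_, fun H f => ?_⟩
  -- Both factors start at height `h μ`, so their product starts at `2 * h μ > h μ`: the quadratic
  -- error in the Leibniz rule has no component `μ`.
  · have hprod : comp μ ((g a - algebraMap ℂ _ (counit a)) * (g b - algebraMap ℂ _ (counit b)))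
        = 0 :=
      mul_mem_heightFiltration hh (hgn a) (hgn b) μ (by have := hh.pos μ hμ; omega)
    have e : g (a * b) = (g a - algebraMap ℂ _ (counit a)) * (g b - algebraMap ℂ _ (counit b)) +
        counit (R := ℂ) a • g b + counit (R := ℂ) b • g a -
        algebraMap ℂ _ (counit a * counit b) := by
      simp only [map_mul, Algebra.smul_def]
      ring
    simp only [component_apply, AlgHom.toLinearMap_apply]
    rw [e, map_sub, map_add, map_add, hprod, comp_algebraMap hμ, sub_zero, zero_add, map_smul,
      map_smul]
  · rw [component_apply, component_apply, weightDefect_eq_zero_iff.1 (hg H), comp_weightOp]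

/-- Composing `x` with linear functionals on `R` yields complex derivations of the same weight, and
these detect `x ≠ 0`. -/
theorem mem_roots_of_ne_zero {α : Module.Dual ℂ (cartan J)} (hα : α ≠ 0)
    {x : WithConv (A →ₗ[ℂ] R)} (hx : x ∈ rootSpaceOver J α R) (hx0 : x ≠ 0) : α ∈ roots J := by
  refine ⟨hα, fun hbot => hx0 ?_⟩
  ext f
  refine (Module.forall_dual_apply_eq_zero_iff ℂ _).1 fun φ => ?_
  have : toConv (φ ∘ₗ x.ofConv) ∈ rootSpace J α := by
    refine mem_rootSpace_iff.2 ⟨fun a b => ?_, fun H f => ?_⟩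
    · simp [hx.1]
    · simp [hx.2]
  rw [hbot, Submodule.mem_bot] at this
  exact congrArg (fun Y : ConvDual A => Y f) this

end Graded

end StokesScattering

end

/-! ### Groups of points with graded coefficients -/

noncomputable section

namespace StokesScattering

open WithConv Coalgebra Polynomial WeightRing

section Points

variable {A : Type} [CommRing A] [HopfAlgebra ℂ A]

/-- The linear map underlying an algebra map, as a homomorphism of convolution monoids. -/
def pointToConv (A S : Type) [CommRing A] [HopfAlgebra ℂ A] [CommRing S] [Algebra ℂ S] :
    WithConv (A →ₐ[ℂ] S) →* WithConv (A →ₗ[ℂ] S) where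
  toFun g := toConv g.ofConv.toLinearMap
  map_one' := rfl
  map_mul' _ _ := rfl

theorem inv_mul_cancel_point {S : Type} [CommRing S] [Algebra ℂ S] (g : WithConv (A →ₐ[ℂ] S)) :
    toConv (g.ofConv.comp (HopfAlgebra.antipodeAlgHom ℂ A)) * g = 1 := by
  have e : toConv (g.ofConv.comp (HopfAlgebra.antipodeAlgHom ℂ A)) * g =
      toConv (g.ofConv.comp (ofConv (toConv (HopfAlgebra.antipodeAlgHom ℂ A) *
        toConv (AlgHom.id ℂ A)))) := by
    refine WithConv.ext ?_
    rw [AlgHom.comp_convMul_distrib]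
    rfl
  rw [e, AlgHom.antipode_id_cancel]
  refine WithConv.ext (AlgHom.ext fun f => ?_)
  exact g.ofConv.commutes _

/-- The group of `S`-valued points of `G`. -/
instance {S : Type} [CommRing S] [Algebra ℂ S] : Group (WithConv (A →ₐ[ℂ] S)) where
  inv g := toConv (g.ofConv.comp (HopfAlgebra.antipodeAlgHom ℂ A))
  inv_mul_cancel := inv_mul_cancel_point

theorem pointToConv_apply {S : Type} [CommRing S] [Algebra ℂ S] (g : WithConv (A →ₐ[ℂ] S))
    (f : A) : pointToConv A S g f = g f := rfl

theorem pointToConv_injective (S : Type) [CommRing S] [Algebra ℂ S] :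
    Function.Injective (pointToConv A S) := fun _ _ h =>
  WithConv.ext (AlgHom.toLinearMap_injective (congrArg ofConv h))

variable (A) in
/-- Functoriality of the group of points. -/
def mapPoint {S S' : Type} [CommRing S] [Algebra ℂ S] [CommRing S'] [Algebra ℂ S']
    (θ : S →ₐ[ℂ] S') : WithConv (A →ₐ[ℂ] S) →* WithConv (A →ₐ[ℂ] S') where
  toFun g := toConv (θ.comp g.ofConv)
  map_one' := by
    refine WithConv.ext (AlgHom.ext fun f => ?_)
    exact θ.commutes _
  map_mul' g g' := WithConv.ext (AlgHom.comp_convMul_distrib θ g g')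

end Points

section Exp

variable {A : Type} [CommRing A] [HopfAlgebra ℂ A] {J : Ideal A}
  {R : Type} [CommRing R] [Algebra ℂ R] {α : Module.Dual ℂ (cartan J)}

/-- The exponential of a derivation of nonzero weight, an `R`-valued point of `G`. -/
def expPoint (hα : α ≠ 0) (x : rootSpaceOver J α R) : A →ₐ[ℂ] R :=
  ((aeval (1 : R)).restrictScalars ℂ).comp (expPoly hα x)

end Exp

section Graded

variable {A : Type} [CommRing A] [HopfAlgebra ℂ A] {J : Ideal A}
  {R : Type} [CommRing R] [Algebra ℂ R] {M : AddSubmonoid (Module.Dual ℂ (cartan J))} {h : M → ℕ}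

/-- The `R[M]`-valued points of the unipotent group with positive weights in `M`. -/
def gradedPoints (A R : Type) [CommRing A] [HopfAlgebra ℂ A] {J : Ideal A} [CommRing R]
    [Algebra ℂ R] {M : AddSubmonoid (Module.Dual ℂ (cartan J))} {h : M → ℕ} (hh : IsHeight h) :
    Subgroup (WithConv (A →ₐ[ℂ] WeightRing R M)) where
  carrier := {g | (∀ H : cartan J, weightDefect H (pointToConv A _ g) = 0) ∧
    pointToConv A _ g - 1 ∈ convFiltration A R h 1}
  one_mem' := ⟨fun H => by rw [map_one, weightDefect_one],
    by rw [map_one, sub_self]; exact zero_mem _⟩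
  mul_mem' := fun {g g'} hg hg' => ⟨fun H => by
    rw [map_mul, weightDefect_mul, hg.1, hg'.1, zero_mul, mul_zero, add_zero], by
    have e : pointToConv A _ (g * g') - 1 =
        pointToConv A _ g * (pointToConv A _ g' - 1) + (pointToConv A _ g - 1) := by
      rw [map_mul, mul_sub, mul_one, sub_add_sub_cancel]
    rw [e]
    refine add_mem ?_ hg.2
    simpa using mul_mem_convFiltration hh (mem_convFiltration_zero (h := h) _) hg'.2⟩
  inv_mem' := fun {g} hg => ⟨fun H => by
    refine weightDefect_of_mul_eq_one (Y := pointToConv A _ g) ?_ ?_ (hg.1 H)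
    · rw [← map_mul, inv_mul_cancel, map_one]
    · rw [← map_mul, mul_inv_cancel, map_one], by
    have e : pointToConv A _ g⁻¹ - 1 =
        -(pointToConv A _ g⁻¹ * (pointToConv A _ g - 1)) := by
      rw [mul_sub, ← map_mul, inv_mul_cancel, map_one, mul_one, neg_sub]
    rw [e]
    refine neg_mem ?_
    simpa using mul_mem_convFiltration hh (mem_convFiltration_zero (h := h) _) hg.2⟩

theorem eq_one_of_mapPoint_augmentation_eq_one (hh : IsHeight h)
    {g : WithConv (A →ₐ[ℂ] WeightRing R M)} (hg : g ∈ gradedPoints A R hh)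
    (h1 : mapPoint A (augmentation R M) g = 1) : g = 1 := by
  refine pointToConv_injective _ ?_
  rw [map_one, ← sub_eq_zero]
  refine eq_zero_of_augmentation_eq_zero (fun H => ?_) fun f => ?_
  · have h2 := weightDefect_eq_zero_iff.1 (hg.1 H)
    have h3 := weightDefect_eq_zero_iff.1 (weightDefect_one (A := A) (R := R) (M := M) H)
    refine weightDefect_eq_zero_iff.2 fun f => ?_
    rw [ofConv_sub, LinearMap.sub_apply, LinearMap.sub_apply, h2, h3, map_sub]
  · have h2 : augmentation R M (g f) = algebraMap ℂ R (counit f) :=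
      congrArg (fun k : WithConv (A →ₐ[ℂ] R) => k f) h1
    rw [ofConv_sub, LinearMap.sub_apply, map_sub, sub_eq_zero, pointToConv_apply, h2]
    exact ((augmentation R M).commutes _).symm

/-- The exponential of `e^μ x` for a derivation `x` of weight `μ ≠ 0`. -/
def gradedExp {μ : M} (hμ : μ.1 ≠ 0) (x : rootSpaceOver J μ.1 R) :
    WithConv (A →ₐ[ℂ] WeightRing R M) :=
  toConv ((substitute R μ).comp (expPoly hμ x))

theorem gradedExp_apply {μ : M} (hμ : μ.1 ≠ 0) (x : rootSpaceOver J μ.1 R) (f : A) :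
    gradedExp hμ x f = substitute R μ (expPoly hμ x f) := rfl

theorem mapPoint_gradedExp {μ : M} (hμ : μ.1 ≠ 0) (x : rootSpaceOver J μ.1 R) :
    mapPoint A (augmentation R M) (gradedExp hμ x) = toConv (expPoint hμ x) := by
  have key : (augmentation R M).comp (substitute R μ) = (aeval (1 : R)).restrictScalars ℂ := by
    refine AlgHom.ext fun p => ?_
    induction p using Polynomial.induction_on' with
    | add p q hp hq => rw [map_add, map_add, hp, hq]
    | monomial n r =>
      rw [AlgHom.comp_apply, substitute_monomial, augmentation_single]
      simp
  refine WithConv.ext ?_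
  change (augmentation R M).comp ((substitute R μ).comp _) = _
  rw [← AlgHom.comp_assoc, key]
  rfl

/-- The terms of degree at least `2` sit at weights `n • μ` of height greater than `h μ`, so only
the linear term is visible up to height `h μ`. -/
theorem comp_substitute (hh : IsHeight h) {μ : M} {p : R[X]} (hp : p.coeff 0 = 0) {ν : M}
    (hν : h ν ≤ h μ) (hμ : μ ≠ 0) :
    comp ν (substitute R μ p) = comp ν (single μ (p.coeff 1)) := by
  have e : ∀ n ∈ p.support, n ≠ 1 → comp ν (substitute R μ (monomial n (p.coeff n))) = 0 := by
    intro n hn h1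
    rw [substitute_monomial]
    refine comp_single_of_ne ?_ _
    rintro rfl
    have hn0 : n ≠ 0 := by
      rintro rfl
      exact mem_support_iff.1 hn hp
    obtain ⟨m, rfl⟩ : ∃ m, n = m + 1 + 1 := ⟨n - 2, by omega⟩
    have h3 := hh.add_le ((m + 1) • μ) μ
    rw [← succ_nsmul] at h3
    have h4 := hh.add_le (m • μ) μ
    rw [← succ_nsmul] at h4
    have := hh.pos μ hμ
    omega
  conv_lhs => rw [p.as_sum_support, map_sum, map_sum]
  rw [Finset.sum_eq_single 1 e]
  · rw [substitute_monomial, one_smul]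
  · intro h1
    rw [notMem_support_iff.1 h1, map_zero, map_zero, map_zero]

theorem comp_gradedExp_sub (hh : IsHeight h) {μ : M} (hμ : μ.1 ≠ 0) (x y : rootSpaceOver J μ.1 R)
    (f : A) {ν : M} (hν : h ν ≤ h μ) :
    comp ν ((pointToConv A _ (gradedExp hμ y) - pointToConv A _ (gradedExp hμ x)) f) =
      comp ν (single μ ((y.1 - x.1) f)) := by
  rw [ofConv_sub, LinearMap.sub_apply, pointToConv_apply, pointToConv_apply, gradedExp_apply,
    gradedExp_apply, ← map_sub, comp_substitute hh _ hν (fun h0 => hμ (congrArg Subtype.val h0)),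
    coeff_sub, coeff_expPoly, coeff_expPoly, divPow_one, divPow_one]
  · rfl
  · rw [coeff_sub, coeff_expPoly, coeff_expPoly, divPow_zero, divPow_zero, sub_self]

theorem gradedExp_zero {μ : M} (hμ : μ.1 ≠ 0) : gradedExp (A := A) (R := R) hμ 0 = 1 := by
  refine WithConv.ext (AlgHom.ext fun f => ?_)
  have : expPoly hμ (0 : rootSpaceOver J μ.1 R) f = monomial 0 (algebraMap ℂ R (counit f)) := by
    ext n
    rw [coeff_expPoly, coeff_monomial]
    cases n with
    | zero => rw [divPow_zero, if_pos rfl]; rfl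
    | succ n =>
      rw [if_neg n.succ_ne_zero.symm, divPow, ZeroMemClass.coe_zero, zero_pow n.succ_ne_zero,
        smul_zero]
      rfl
  rw [gradedExp_apply, this, substitute_monomial, zero_smul]
  rfl

theorem gradedExp_mem (hh : IsHeight h) {μ : M} (hμ : μ.1 ≠ 0) (x : rootSpaceOver J μ.1 R) :
    gradedExp hμ x ∈ gradedPoints A R hh := by
  refine ⟨fun H => weightDefect_eq_zero_iff.2 fun f => ?_, fun f ν hν => ?_⟩
  · rw [pointToConv_apply, pointToConv_apply, gradedExp_apply, gradedExp_apply]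
    obtain ⟨N, hN⟩ : ∃ N, (expPoly hμ x (coad (H : ConvDual A) f)).natDegree < N ∧
        (expPoly hμ x f).natDegree < N :=
      ⟨_, Nat.lt_succ_of_le (le_max_left _ _), Nat.lt_succ_of_le (le_max_right _ _)⟩
    rw [as_sum_range' _ N hN.1, as_sum_range' (expPoly hμ x f) N hN.2, map_sum, map_sum, map_sum]
    refine Finset.sum_congr rfl fun n _ => ?_
    rw [coeff_expPoly, coeff_expPoly, substitute_monomial, substitute_monomial, weightOp_single,
      divPow_apply_coad x.2]
    ext κ
    rw [map_smul]
    by_cases hκ : n • μ = κ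
    · subst hκ
      rw [comp_single_self, comp_single_self]
      congr 1
      simp
    · rw [comp_single_of_ne hκ, comp_single_of_ne hκ, smul_zero]
  · have hν0 : ν = 0 := by
      by_contra h0
      have := hh.pos ν h0
      omega
    have hμ0 : μ ≠ 0 := fun h0 => hμ (congrArg Subtype.val h0)
    have := comp_gradedExp_sub hh hμ 0 x f (ν := ν) (by rw [hν0, hh.map_zero]; exact Nat.zero_le _)
    rw [gradedExp_zero, map_one] at this
    rw [this, comp_single_of_ne (by rw [hν0]; exact hμ0)]

end Graded

end StokesScattering

end

/-! ### Solving the ordered product height by height -/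

noncomputable section

namespace StokesScattering

open WithConv Coalgebra Polynomial WeightRing

namespace ScatteringDiagram

variable {A : Type} [CommRing A] [HopfAlgebra ℂ A] {J : Ideal A} (D : ScatteringDiagram J)
  {R : Type} [CommRing R] [Algebra ℂ R]

/-- The monoid of weights generated by the incoming rays. -/
abbrev weights : AddSubmonoid (Module.Dual ℂ (cartan J)) := AddSubmonoid.closure D.Cin

/-- An outgoing root as a weight. -/
abbrev outWeight (γ : D.Cout) : D.weights := ⟨γ.1, γ.2.2⟩

/-- An incoming root as a weight. -/
abbrev inWeight (γ : D.Cin) : D.weights := ⟨γ.1, AddSubmonoid.subset_closure γ.2⟩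

theorem outWeight_ne_zero (γ : D.Cout) : (D.outWeight γ).1 ≠ 0 := γ.2.1.1

theorem inWeight_ne_zero (γ : D.Cin) : (D.inWeight γ).1 ≠ 0 := by
  obtain ⟨_, _, ⟨l, hl, rfl, rfl⟩, hC⟩ := D.convex
  exact (hC γ.2).1.1

theorem exists_isHeight : ∃ h : D.weights → ℕ, IsHeight h := by
  obtain ⟨_, _, ⟨l, hl, rfl, rfl⟩, hC⟩ := D.convex
  exact StokesScattering.exists_isHeight D.finite_in l fun γ hγ => (hC hγ).2

/-- The ordered product over a list of rays, in the group of `R[M]`-valued points. -/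
def gradedProduct (l : List D.Rays) (a : D.Cin → WithConv (A →ₐ[ℂ] WeightRing R D.weights))
    (y : ∀ γ : D.Cout, rootSpaceOver J γ.1 R) : WithConv (A →ₐ[ℂ] WeightRing R D.weights) :=
  (l.map (Sum.elim a fun γ => gradedExp (D.outWeight_ne_zero γ) (y γ))).prod

variable {D} {h : D.weights → ℕ} (hh : IsHeight h)
  {a : D.Cin → WithConv (A →ₐ[ℂ] WeightRing R D.weights)} {l : List D.Rays}

include hh in
theorem gradedProduct_mem (ha : ∀ γ, a γ ∈ gradedPoints A R hh)
    (y : ∀ γ : D.Cout, rootSpaceOver J γ.1 R) :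
    D.gradedProduct l a y ∈ gradedPoints A R hh := by
  refine Subgroup.list_prod_mem _ fun x hx => ?_
  obtain ⟨r | r, -, rfl⟩ := List.mem_map.1 hx
  · exact ha r
  · exact gradedExp_mem hh _ _

include hh in
/-- Changing the outgoing factors in heights at least `n`. -/
theorem comp_gradedProduct_sub (ha : ∀ γ, a γ ∈ gradedPoints A R hh) (hl : l.Nodup)
    (hl' : ∀ r, r ∈ l) {n : ℕ} (hn : 1 ≤ n) {y z : ∀ γ : D.Cout, rootSpaceOver J γ.1 R}
    (hyz : ∀ γ, z γ = y γ ∨ n ≤ h (D.outWeight γ)) (μ : D.weights) (hμ : h μ ≤ n) (f : A) :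
    comp μ (D.gradedProduct l a z f) = comp μ (D.gradedProduct l a y f) +
      ∑ᶠ γ : D.Cout, comp μ (single (D.outWeight γ) (((z γ).1 - (y γ).1) f)) := by
  classical
  have : Fintype D.Cin := Fintype.ofFinite _
  have : Fintype D.Cout := Fintype.ofFinite _
  let b (y : ∀ γ : D.Cout, rootSpaceOver J γ.1 R) (r : D.Rays) :
      WithConv (A →ₗ[ℂ] WeightRing R D.weights) :=
    pointToConv A _ (Sum.elim a (fun γ => gradedExp (D.outWeight_ne_zero γ) (y γ)) r)
  have hb : ∀ y, pointToConv A _ (D.gradedProduct l a y) = (l.map (b y)).prod := fun y => by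
    rw [gradedProduct, map_list_prod, List.map_map]
    rfl
  have hb1 : ∀ i, b y i - 1 ∈ convFiltration A R h 1 := by
    rintro (γ | γ)
    · exact (ha γ).2
    · exact (gradedExp_mem hh (D.outWeight_ne_zero γ) (y γ)).2
  have hterm : ∀ γ : D.Cout, ∀ ν, h ν ≤ n → comp ν ((b z (.inr γ) - b y (.inr γ)) f) =
      comp ν (single (D.outWeight γ) (((z γ).1 - (y γ).1) f)) := fun γ ν hν => by
    rcases hyz γ with h1 | h1
    · simp only [b, Sum.elim_inr, h1, sub_self]
      rw [ofConv_zero, ofConv_zero, LinearMap.zero_apply, LinearMap.zero_apply, single_zero]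
    · exact comp_gradedExp_sub hh _ _ _ _ (hν.trans h1)
  have hbn : ∀ i, b z i - b y i ∈ convFiltration A R h n := by
    rintro (γ | γ) g ν hν
    · simp only [b, Sum.elim_inl, sub_self]
      exact map_zero _
    · rcases hyz γ with h1 | h1
      · simp only [b, Sum.elim_inr, h1, sub_self]
        exact map_zero _
      · refine (comp_gradedExp_sub hh _ _ _ _ (hν.le.trans h1)).trans (comp_single_of_ne ?_ _)
        rintro rfl
        omega
  have key := list_prod_perturbation hh l hn hb1 hbn f μ (Nat.lt_succ_of_le hμ)
  rw [← hb, ← hb, ← List.sum_toFinset _ hl,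
    show l.toFinset = Finset.univ from Finset.eq_univ_iff_forall.2 fun r => List.mem_toFinset.2 (hl' r),
    ofConv_sub, ofConv_sub, LinearMap.sub_apply, LinearMap.sub_apply, map_sub, map_sub,
    sub_sub, sub_eq_zero] at key
  rw [pointToConv_apply, pointToConv_apply] at key
  have hsum : ∀ F : D.Rays → R, ∑ i, F i = ∑ γ, F (.inl γ) + ∑ γ, F (.inr γ) := fun F => by
    convert Fintype.sum_sum_type F
  rw [key, finsum_eq_sum_of_fintype, ofConv_sum, LinearMap.sum_apply, map_sum, hsum]
  congr 1
  have h0 : ∀ γ, comp μ ((b z (.inl γ) - b y (.inl γ)) f) = 0 := fun γ => by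
    simp only [b, Sum.elim_inl, sub_self]
    exact map_zero _
  rw [Finset.sum_eq_zero fun γ _ => h0 γ, zero_add]
  exact Finset.sum_congr rfl fun γ _ => hterm γ μ hμ

theorem finsum_comp_single (x : D.Cout → R) (γ : D.Cout) :
    ∑ᶠ κ : D.Cout, comp (D.outWeight γ) (single (D.outWeight κ) (x κ)) = x γ := by
  rw [finsum_eq_single _ γ fun κ hκ => comp_single_of_ne (fun he => hκ ?_) _, comp_single_self]
  exact Subtype.ext (congrArg (fun μ : D.weights => μ.1) he)

theorem finsum_comp_single_of_notMem (x : D.Cout → R) {μ : D.weights}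
    (hμ : ∀ γ, D.outWeight γ ≠ μ) :
    ∑ᶠ κ : D.Cout, comp μ (single (D.outWeight κ) (x κ)) = 0 := by
  rw [← finsum_zero (α := D.Cout)]
  exact finsum_congr fun κ => comp_single_of_ne (hμ κ) _

include hh in
/-- The obstruction in height `n` lies in the outgoing root spaces. -/
theorem mem_convFiltration_succ {g : WithConv (A →ₐ[ℂ] WeightRing R D.weights)}
    (hg : g ∈ gradedPoints A R hh) {n : ℕ} (hn : 1 ≤ n)
    (hgn : pointToConv A _ g - 1 ∈ convFiltration A R h n)
    (h0 : ∀ γ : D.Cout, h (D.outWeight γ) = n → ∀ f, comp (D.outWeight γ) (g f) = 0) :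
    pointToConv A _ g - 1 ∈ convFiltration A R h (n + 1) := fun f μ hμ => by
  rcases (Nat.lt_succ_iff.1 hμ).lt_or_eq with hlt | heq
  · exact hgn f μ hlt
  have hμ0 : μ ≠ 0 := by
    rintro rfl
    rw [hh.map_zero] at heq
    omega
  rw [ofConv_sub, LinearMap.sub_apply, map_sub, LinearMap.convOne_apply, comp_algebraMap hμ0,
    sub_zero]
  subst heq
  -- The component is a derivation of weight `μ`. Were it nonzero, `μ` would be a root in the monoid
  -- generated by `Cin`, hence outgoing.
  have hmem := component_mem_rootSpaceOver hh g.ofConv hg.1 hμ0 hgn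
  by_cases hout : μ.1 ∈ D.Cout
  · exact h0 ⟨μ.1, hout⟩ rfl f
  · by_contra hne
    refine hout ⟨mem_roots_of_ne_zero (fun h => hμ0 (Subtype.ext h)) hmem fun hz => hne ?_, μ.2⟩
    exact congrArg (fun Y : WithConv (A →ₗ[ℂ] R) => Y f) hz

include hh in
theorem exists_gradedProduct_sub_one_mem (ha : ∀ γ, a γ ∈ gradedPoints A R hh) (hl : l.Nodup)
    (hl' : ∀ r, r ∈ l) (n : ℕ) : ∃ y : ∀ γ : D.Cout, rootSpaceOver J γ.1 R,
      pointToConv A _ (D.gradedProduct l a y) - 1 ∈ convFiltration A R h (n + 1) := by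
  classical
  induction n with
  | zero => exact ⟨0, (gradedProduct_mem hh ha 0).2⟩
  | succ n ih =>
    obtain ⟨y, hy⟩ := ih
    have hmem := gradedProduct_mem (l := l) hh ha y
    have hμ0 : ∀ γ, D.outWeight γ ≠ 0 := fun γ h0 =>
      D.outWeight_ne_zero γ (congrArg Subtype.val h0)
    -- Subtracting the component `γ` of the error from `y γ` cancels it exactly, since the
    -- dependence on `y γ` at this height is additive.
    let z : ∀ γ : D.Cout, rootSpaceOver J γ.1 R := fun γ =>
      if hγ : h (D.outWeight γ) = n + 1 then
        y γ - ⟨component (D.outWeight γ) (pointToConv A _ (D.gradedProduct l a y)),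
          component_mem_rootSpaceOver hh _ hmem.1 (hμ0 γ) (by rw [hγ]; exact hy)⟩
      else y γ
    have hyz : ∀ γ, z γ = y γ ∨ n + 1 ≤ h (D.outWeight γ) := fun γ => by
      by_cases hγ : h (D.outWeight γ) = n + 1
      · exact Or.inr hγ.ge
      · exact Or.inl (dif_neg hγ)
    have hsub := comp_gradedProduct_sub hh ha hl hl' (Nat.succ_le_succ (Nat.zero_le n)) hyz
    refine ⟨z, mem_convFiltration_succ hh (gradedProduct_mem hh ha z) (by omega) ?_ ?_⟩
    · intro f μ hμ
      have hy' := hy f μ hμ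
      rw [ofConv_sub, LinearMap.sub_apply, map_sub, pointToConv_apply] at hy' ⊢
      rw [hsub μ hμ.le, add_sub_right_comm, hy', zero_add]
      by_cases hout : ∃ γ, D.outWeight γ = μ
      · obtain ⟨γ, rfl⟩ := hout
        rw [finsum_comp_single (fun γ => ((z γ).1 - (y γ).1) f),
          show z γ = y γ from dif_neg hμ.ne, sub_self]
        rfl
      · exact finsum_comp_single_of_notMem (fun γ => ((z γ).1 - (y γ).1) f)
          fun γ hγ => hout ⟨γ, hγ⟩
    · intro γ hγ f
      rw [hsub _ hγ.le, finsum_comp_single (fun γ => ((z γ).1 - (y γ).1) f)]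
      simp only [z, dif_pos hγ]
      rw [Submodule.coe_sub, sub_sub_cancel_left]
      exact add_neg_cancel _

include hh in
-- By induction on height: once the factors agree below height `n`, the components of the products
-- at an outgoing `γ` of height `n` differ by exactly `z γ - y γ`.
theorem gradedProduct_injective (ha : ∀ γ, a γ ∈ gradedPoints A R hh) (hl : l.Nodup)
    (hl' : ∀ r, r ∈ l) : Function.Injective (D.gradedProduct l a) := fun z y hzy => by
  have key : ∀ n, ∀ γ, h (D.outWeight γ) < n → z γ = y γ := fun n => by
    induction n with
    | zero => exact fun γ hγ => absurd hγ (Nat.not_lt_zero _)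
    | succ n ih =>
      intro γ hγ
      rcases (Nat.lt_succ_iff.1 hγ).lt_or_eq with hlt | heq
      · exact ih γ hlt
      have hn : 1 ≤ n := heq ▸ hh.pos _ fun h0 =>
        D.outWeight_ne_zero γ (congrArg Subtype.val h0)
      have hsub := comp_gradedProduct_sub hh ha hl hl' hn (y := y) (z := z)
        (fun γ => (lt_or_ge (h (D.outWeight γ)) n).imp (ih γ) id) (D.outWeight γ) heq.le
      refine Subtype.ext (sub_eq_zero.1 (WithConv.ext (LinearMap.ext fun f => ?_)))
      have h1 := hsub f
      rw [hzy, left_eq_add, finsum_comp_single (fun γ => ((z γ).1 - (y γ).1) f)] at h1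
      exact h1
  exact funext fun γ => key _ γ (Nat.lt_succ_self _)

include hh in
theorem existsUnique_gradedProduct_eq_one (ha : ∀ γ, a γ ∈ gradedPoints A R hh) (hl : l.Nodup)
    (hl' : ∀ r, r ∈ l) : ∃! y, D.gradedProduct l a y = 1 := by
  obtain ⟨N, hN⟩ : ∃ N, ∀ γ : D.Cout, h (D.outWeight γ) ≤ N := by
    obtain ⟨N, hN⟩ := (Set.finite_range fun γ : D.Cout => h (D.outWeight γ)).bddAbove
    exact ⟨N, fun γ => hN ⟨γ, rfl⟩⟩
  obtain ⟨y, hy⟩ := exists_gradedProduct_sub_one_mem hh ha hl hl' N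
  -- Above `N` there are no outgoing weights, hence no obstructions, so the same `y` is correct to
  -- every order.
  have hall : ∀ n, pointToConv A _ (D.gradedProduct l a y) - 1 ∈
      convFiltration A R h (N + 1 + n) := fun n => by
    induction n with
    | zero => exact hy
    | succ n ih =>
      refine mem_convFiltration_succ (n := N + 1 + n) hh (gradedProduct_mem hh ha y) (by omega) ih
        fun γ hγ => ?_
      have := hN γ
      omega
  have hy1 : D.gradedProduct l a y = 1 := by
    refine pointToConv_injective _ ?_
    rw [map_one, ← sub_eq_zero]
    exact eq_zero_of_forall_mem_convFiltration (h := h) fun n =>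
      convFiltration_mono (n := N + 1 + n) (by omega) (hall n)
  exact ⟨y, hy1, fun z hz => gradedProduct_injective hh ha hl hl' (hz.trans hy1.symm)⟩

variable (D) in
/-- The ordered product of exponentials over a list of rays has a unique solution. -/
theorem existsUnique_prod_expPoint_eq_one (hl : l.Nodup) (hl' : ∀ r, r ∈ l)
    (x : ∀ γ : D.Cin, rootSpaceOver J γ.1 R) : ∃! y : ∀ γ : D.Cout, rootSpaceOver J γ.1 R,
      (l.map (Sum.elim (fun γ => (toConv (expPoint (D.inWeight_ne_zero γ) (x γ)))⁻¹)
        fun γ => toConv (expPoint (D.outWeight_ne_zero γ) (y γ)))).prod = 1 := by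
  obtain ⟨h, hh⟩ := D.exists_isHeight
  let a : D.Cin → WithConv (A →ₐ[ℂ] WeightRing R D.weights) := fun γ =>
    (gradedExp (D.inWeight_ne_zero γ) (x γ))⁻¹
  have ha : ∀ γ, a γ ∈ gradedPoints A R hh := fun γ => inv_mem (gradedExp_mem hh _ _)
  -- Setting all `e^μ` to `1` maps the graded product to the original one; the converse uses
  -- independence of weights.
  have key : ∀ y, (l.map (Sum.elim (fun γ => (toConv (expPoint (D.inWeight_ne_zero γ) (x γ)))⁻¹)
      fun γ => toConv (expPoint (D.outWeight_ne_zero γ) (y γ)))).prod = 1 ↔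
      D.gradedProduct l a y = 1 := fun y => by
    have e : (l.map (Sum.elim (fun γ => (toConv (expPoint (D.inWeight_ne_zero γ) (x γ)))⁻¹)
        fun γ => toConv (expPoint (D.outWeight_ne_zero γ) (y γ)))).prod =
        mapPoint A (augmentation R D.weights) (D.gradedProduct l a y) := by
      rw [gradedProduct, map_list_prod, List.map_map]
      congr 2
      funext r
      rcases r with γ | γ
      · simp only [Sum.elim_inl, Function.comp_apply, a, map_inv, mapPoint_gradedExp]
      · simp only [Sum.elim_inr, Function.comp_apply, mapPoint_gradedExp]
    rw [e]
    exact ⟨eq_one_of_mapPoint_augmentation_eq_one hh (gradedProduct_mem hh ha y),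
      fun h1 => by rw [h1, map_one]⟩
  simp only [key]
  exact existsUnique_gradedProduct_eq_one hh ha hl hl'

end ScatteringDiagram

end StokesScattering

end

/-! ### Root subgroups as affine spaces of derivations -/

noncomputable section

namespace StokesScattering

open WithConv Coalgebra Polynomial

section RootSubgroup

variable {A : Type} [CommRing A] [HopfAlgebra ℂ A] {J : Ideal A}
  {R S : Type} [CommRing R] [Algebra ℂ R] [CommRing S] [Algebra ℂ S]
  {α : Module.Dual ℂ (cartan J)}

theorem aeval_one_expPoly (hα : α ≠ 0) (x : rootSpaceOver J α R) (f : A) :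
    expPoint hα x f = (expPoly hα x f).eval 1 := by
  rw [← Polynomial.coe_aeval_eq_eval]
  rfl

/-- Functoriality of root spaces in the coefficients. -/
def mapRoot (θ : S →ₐ[ℂ] R) (x : rootSpaceOver J α S) : rootSpaceOver J α R :=
  ⟨toConv (θ.toLinearMap ∘ₗ x.1.ofConv), fun a b => by simp [x.2.1], fun H f => by simp [x.2.2]⟩

theorem mapRoot_apply (θ : S →ₐ[ℂ] R) (x : rootSpaceOver J α S) (f : A) :
    (mapRoot θ x).1 f = θ (x.1 f) := rfl

theorem mapRoot_pow (θ : S →ₐ[ℂ] R) (x : rootSpaceOver J α S) (n : ℕ) (f : A) :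
    ((mapRoot θ x).1 ^ n) f = θ ((x.1 ^ n) f) := by
  have h : (mapRoot θ x).1 ^ n = toConv (θ.toLinearMap ∘ₗ (x.1 ^ n).ofConv) := by
    induction n with
    | zero =>
      ext f
      exact (θ.commutes _).symm
    | succ n ih =>
      rw [pow_succ, pow_succ, ih, LinearMap.algHom_comp_convMul_distrib]
      rfl
  rw [h]
  rfl

theorem expPoint_mapRoot (hα : α ≠ 0) (θ : S →ₐ[ℂ] R) (x : rootSpaceOver J α S) :
    expPoint hα (mapRoot θ x) = θ.comp (expPoint hα x) := by
  refine AlgHom.ext fun f => ?_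
  have h : expPoly hα (mapRoot θ x) f = (expPoly hα x f).map (θ : S →+* R) := by
    ext n
    rw [coeff_expPoly, coeff_map, coeff_expPoly, divPow, divPow, ofConv_smul, ofConv_smul,
      LinearMap.smul_apply, LinearMap.smul_apply, mapRoot_pow]
    exact (map_smul θ _ _).symm
  rw [aeval_one_expPoly, h, Polynomial.eval_map, eval₂_at_one, AlgHom.comp_apply, aeval_one_expPoly]
  rfl

/-- A derivation of nonzero weight is determined, uniformly, by its exponential. -/
theorem exists_forall_expPoint_apply_eq (hα : α ≠ 0) (f : A) :
    ∃ g : A, ∀ (R : Type) [CommRing R] [Algebra ℂ R] (x : rootSpaceOver J α R),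
      expPoint hα x g = x.1 f := by
  obtain ⟨H, hH⟩ := exists_apply_ne_zero hα
  obtain ⟨g, hg⟩ := exists_weight_one_projection (H : ConvDual A) hH f
  refine ⟨g, fun R _ _ x => ?_⟩
  have : expPoly hα x g = monomial 1 (x.1 f) := by
    ext n
    rw [coeff_expPoly, hg n R _ (divPow_apply_coad x.2 n H), coeff_monomial]
    by_cases h : n = 1
    · rw [if_pos h, if_pos h.symm, h, divPow_one]
    · rw [if_neg h, if_neg (Ne.symm h)]
  rw [aeval_one_expPoly, this, eval_monomial, one_pow, mul_one]

theorem expPoint_injective (hα : α ≠ 0) :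
    Function.Injective (expPoint hα : rootSpaceOver J α R → (A →ₐ[ℂ] R)) := fun x y hxy => by
  refine Subtype.ext (WithConv.ext (LinearMap.ext fun f => ?_))
  obtain ⟨g, hg⟩ := exists_forall_expPoint_apply_eq hα f
  rw [← hg, ← hg, hxy]

theorem isExp_iff (hα : α ≠ 0) (X : rootSpaceOver J α ℂ) (g : A →ₐ[ℂ] ℂ) :
    IsExp X.1 g ↔ g = expPoint hα X := by
  have h : IsExp X.1 (expPoint hα X) := fun f => by
    obtain ⟨N, hN⟩ := exists_forall_divPow_apply_eq_zero hα f
    have h1 : expPoint hα X f = ∑ n ∈ Finset.range N, (n.factorial : ℂ)⁻¹ * (X.1 ^ n) f := by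
      have hdeg : (expPoly hα X f).support ⊆ Finset.range N := fun n hn => by
        rw [mem_support_iff, coeff_expPoly] at hn
        exact Finset.mem_range.2 (not_le.1 fun hle => hn (hN n hle ℂ X.1 X.2))
      rw [aeval_one_expPoly, eval_eq_sum, Polynomial.sum_def,
        Finset.sum_subset hdeg fun n _ hn => by rw [notMem_support_iff.1 hn, zero_mul]]
      refine Finset.sum_congr rfl fun n _ => ?_
      rw [one_pow, mul_one, coeff_expPoly]
      rfl
    rw [h1]
    exact hasSum_sum_of_ne_finset_zero fun n hn =>
      hN n (not_lt.1 fun hlt => hn (Finset.mem_range.2 hlt)) ℂ X.1 X.2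
  exact ⟨fun hg => AlgHom.ext fun f => (hg f).unique (h f), fun hg => hg ▸ h⟩

theorem mem_rootSubgroupIdeal_iff (hα : α ≠ 0) (f : A) :
    f ∈ rootSubgroupIdeal J α ↔ ∀ X : rootSpaceOver J α ℂ, expPoint hα X f = 0 := by
  rw [rootSubgroupIdeal]
  simp only [Submodule.mem_iInf, Set.mem_ofPred_eq, RingHom.mem_ker]
  refine ⟨fun h X => h _ ⟨X.1, mem_rootSpace_iff.2 X.2, (isExp_iff hα X _).2 rfl⟩, ?_⟩
  rintro h g ⟨X, hX, hg⟩
  have := (isExp_iff hα ⟨X, mem_rootSpace_iff.1 hX⟩ g).1 hg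
  rw [this]
  exact h _

theorem extendScalars_mem {X : ConvDual A} (hX : X ∈ rootSpaceOver J α ℂ) :
    extendScalars R X ∈ rootSpaceOver J α R :=
  (mapRoot (Algebra.ofId ℂ R) ⟨X, hX⟩).2

/-- By the Leibniz rule at the identity, values on products are complex combinations of values on
the factors. With finitely many generators this makes the values of `x` span a finite-dimensional
space. -/
theorem apply_mem_span {s : Set A} (hs : Algebra.adjoin ℂ s = ⊤) {x : WithConv (A →ₗ[ℂ] R)}
    (hx : x ∈ rootSpaceOver J α R) (f : A) : x f ∈ Submodule.span ℂ (x.ofConv '' s) := by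
  have hf : f ∈ Algebra.adjoin ℂ s := hs ▸ Algebra.mem_top
  induction hf using Algebra.adjoin_induction with
  | mem a ha => exact Submodule.subset_span ⟨a, ha, rfl⟩
  | algebraMap c =>
    rw [Algebra.algebraMap_eq_smul_one, map_smul, apply_one_of_mem_rootSpaceOver hx, smul_zero]
    exact zero_mem _
  | add a b _ _ ha hb => rw [map_add]; exact add_mem ha hb
  | mul a b _ _ ha hb =>
    rw [hx.1]
    exact add_mem (Submodule.smul_mem _ _ hb) (Submodule.smul_mem _ _ ha)

variable [Algebra.FiniteType ℂ A]

instance : Module.Finite ℂ (rootSpaceOver J α ℂ) := by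
  obtain ⟨s, hs⟩ := Algebra.FiniteType.out (R := ℂ) (A := A)
  let L : rootSpaceOver J α ℂ →ₗ[ℂ] (s → ℂ) :=
    { toFun := fun X a => X.1 a.1
      map_add' := fun _ _ => rfl
      map_smul' := fun _ _ => rfl }
  refine Module.Finite.of_injective L ?_
  rw [← LinearMap.ker_eq_bot, LinearMap.ker_eq_bot']
  intro X hX
  refine Subtype.ext (WithConv.ext (LinearMap.ext fun f => ?_))
  have h := apply_mem_span hs X.2 f
  have h0 : Submodule.span ℂ (X.1.ofConv '' (s : Set A)) = ⊥ := by
    rw [Submodule.span_eq_bot]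
    rintro _ ⟨a, ha, rfl⟩
    exact congrFun hX ⟨a, ha⟩
  rw [h0, Submodule.mem_bot] at h
  exact h

variable (J α) in
/-- A basis of the root space. -/
def rootBasis : Module.Basis (Fin (Module.finrank ℂ (rootSpaceOver J α ℂ))) ℂ
    (rootSpaceOver J α ℂ) := Module.finBasis ℂ _

variable (J α) in
/-- The coordinate ring of the root space. -/
abbrev RootCoord : Type := MvPolynomial (Fin (Module.finrank ℂ (rootSpaceOver J α ℂ))) ℂ

variable (J α) in
/-- The universal element of the root space. -/
def universalRoot : rootSpaceOver J α (RootCoord J α) :=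
  ∑ i, (MvPolynomial.X i : RootCoord J α) • ⟨extendScalars _ (rootBasis J α i).1,
    extendScalars_mem (rootBasis J α i).2⟩

theorem universalRoot_apply (f : A) : (universalRoot J α).1 f =
    ∑ i, (rootBasis J α i).1 f • (MvPolynomial.X i : RootCoord J α) := by
  rw [universalRoot, Submodule.coe_sum, ofConv_sum, LinearMap.sum_apply]
  refine Finset.sum_congr rfl fun i _ => ?_
  rw [Algebra.smul_def, mul_comm]
  rfl

/-- The coordinates of `x` in a basis of the finite-dimensional span of its values are complex
derivations of the same weight. Thus the root space over `R` arises by extension of scalars. -/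
theorem exists_eq_sum_smul (x : rootSpaceOver J α R) :
    ∃ (n : ℕ) (w : Fin n → R) (X : Fin n → rootSpaceOver J α ℂ),
      ∀ f, x.1 f = ∑ j, (X j).1 f • w j := by
  obtain ⟨s, hs⟩ := Algebra.FiniteType.out (R := ℂ) (A := A)
  let W := Submodule.span ℂ (x.1.ofConv '' (s : Set A))
  have : Module.Finite ℂ W := Module.Finite.span_of_finite ℂ ((Finset.finite_toSet s).image _)
  let w := Module.finBasis ℂ W
  let xW : A →ₗ[ℂ] W := x.1.ofConv.codRestrict W fun f => apply_mem_span hs x.2 f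
  have hmem : ∀ j, toConv ((w.coord j) ∘ₗ xW) ∈ rootSpaceOver J α ℂ := fun j => by
    refine ⟨fun a b => ?_, fun H f => ?_⟩
    · have : xW (a * b) = counit (R := ℂ) a • xW b + counit (R := ℂ) b • xW a :=
        Subtype.ext (x.2.1 a b)
      simp [this]
    · have : xW (coad (H : ConvDual A) f) = α H • xW f := Subtype.ext (x.2.2 H f)
      simp [this]
  refine ⟨_, fun j => (w j : R), fun j => ⟨_, hmem j⟩, fun f => ?_⟩
  have h := congrArg W.subtype (w.sum_repr (xW f))
  rw [map_sum] at h
  exact h.symm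

theorem exists_eq_mapRoot_universalRoot (x : rootSpaceOver J α R) :
    ∃ r, x = mapRoot (MvPolynomial.aeval r : RootCoord J α →ₐ[ℂ] R) (universalRoot J α) := by
  obtain ⟨n, w, X', hx⟩ := exists_eq_sum_smul x
  refine ⟨fun i => ∑ j, (rootBasis J α).repr (X' j) i • w j,
    Subtype.ext (WithConv.ext (LinearMap.ext fun f => ?_))⟩
  have h1 : ∀ j, (X' j).1 f = ∑ i, (rootBasis J α).repr (X' j) i * (rootBasis J α i).1 f :=
    fun j => by
      have h := congrArg (fun Y : rootSpaceOver J α ℂ => Y.1 f) ((rootBasis J α).sum_repr (X' j))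
      simp only [Submodule.coe_sum, ofConv_sum, LinearMap.sum_apply] at h
      exact h.symm
  rw [hx, mapRoot_apply, universalRoot_apply, map_sum]
  simp only [h1, map_smul, MvPolynomial.aeval_X, Finset.sum_smul, Finset.smul_sum, smul_smul]
  rw [Finset.sum_comm]
  simp only [mul_comm]

/-- The ideal of `U_α` is defined by complex points. A polynomial over the infinite field `ℂ`
vanishing at all of them is zero, so this ideal is the kernel of the universal exponential. -/
theorem expPoint_universalRoot_eq_zero_iff (hα : α ≠ 0) (f : A) :
    expPoint hα (universalRoot J α) f = 0 ↔ f ∈ rootSubgroupIdeal J α := by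
  rw [mem_rootSubgroupIdeal_iff hα]
  refine ⟨fun h X => ?_, fun h => MvPolynomial.funext fun c => ?_⟩
  · obtain ⟨c, hc⟩ := exists_eq_mapRoot_universalRoot X
    rw [hc, expPoint_mapRoot, AlgHom.comp_apply, h, map_zero]
  · have := h (mapRoot (MvPolynomial.aeval c) (universalRoot J α))
    rw [expPoint_mapRoot, AlgHom.comp_apply] at this
    rw [map_zero, ← this, MvPolynomial.aeval_def, MvPolynomial.eval₂_eq_eval_map]
    simp [MvPolynomial.eval_map]

/-- Derivations are determined by their values and the root space is finite-dimensional, so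
evaluation maps `A` onto its dual. -/
theorem exists_rootBasis_apply (i : Fin (Module.finrank ℂ (rootSpaceOver J α ℂ))) :
    ∃ f : A, ∀ j, (rootBasis J α j).1 f = if j = i then 1 else 0 := by
  let B : A →ₗ[ℂ] rootSpaceOver J α ℂ →ₗ[ℂ] ℂ := LinearMap.mk₂ ℂ (fun f X => X.1 f)
    (fun f g X => map_add _ _ _) (fun c f X => map_smul _ _ _) (fun f X Y => rfl)
    (fun c f X => rfl)
  have hB : Function.Surjective B := by
    refine LinearMap.flip_injective_iff₂.1 fun X Y hXY => ?_
    exact Subtype.ext (WithConv.ext (LinearMap.ext fun f => LinearMap.congr_fun hXY f))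
  obtain ⟨f, hf⟩ := hB ((rootBasis J α).coord i)
  refine ⟨f, fun j => (LinearMap.congr_fun hf (rootBasis J α j)).trans ?_⟩
  rw [Module.Basis.coord_apply, Module.Basis.repr_self, Finsupp.single_apply]

theorem exists_expPoint_universalRoot_eq_X (hα : α ≠ 0)
    (i : Fin (Module.finrank ℂ (rootSpaceOver J α ℂ))) :
    ∃ g : A, expPoint hα (universalRoot J α) g = MvPolynomial.X i := by
  obtain ⟨f, hf⟩ := exists_rootBasis_apply i
  obtain ⟨g, hg⟩ := exists_forall_expPoint_apply_eq hα f
  refine ⟨g, ?_⟩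
  rw [hg, universalRoot_apply]
  simp [hf]

theorem expPoint_apply_eq_zero (hα : α ≠ 0) (x : rootSpaceOver J α R) {f : A}
    (hf : f ∈ rootSubgroupIdeal J α) : expPoint hα x f = 0 := by
  obtain ⟨r, hr⟩ := exists_eq_mapRoot_universalRoot x
  rw [hr, expPoint_mapRoot, AlgHom.comp_apply, (expPoint_universalRoot_eq_zero_iff hα f).2 hf,
    map_zero]

/-- Every point of the root subgroup is an exponential. -/
theorem exists_expPoint_eq (hα : α ≠ 0) (v : A →ₐ[ℂ] R)
    (hv : ∀ f ∈ rootSubgroupIdeal J α, v f = 0) : ∃ x, expPoint hα x = v := by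
  choose g hg using exists_expPoint_universalRoot_eq_X (J := J) hα
  refine ⟨mapRoot (MvPolynomial.aeval fun i => v (g i)) (universalRoot J α), ?_⟩
  rw [expPoint_mapRoot]
  refine AlgHom.ext fun f => ?_
  set P := expPoint hα (universalRoot J α) f with hP
  -- The functions `g i` restrict to the coordinates of `U_α`; modulo its ideal, `f` is the
  -- polynomial `P` in them, so `v` is determined by the values `v (g i)`.
  have h1 : f - MvPolynomial.aeval g P ∈ rootSubgroupIdeal J α := by
    rw [← expPoint_universalRoot_eq_zero_iff hα, map_sub, ← AlgHom.comp_apply _ (MvPolynomial.aeval g),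
      MvPolynomial.comp_aeval]
    simp only [hg, MvPolynomial.aeval_X_left, AlgHom.id_apply, hP, sub_self]
  have h2 := hv _ h1
  rw [map_sub, sub_eq_zero, ← AlgHom.comp_apply v, MvPolynomial.comp_aeval] at h2
  exact h2.symm

end RootSubgroup

end StokesScattering

end

/-! ### From algebras to schemes over `ℂ` -/

noncomputable section

namespace StokesScattering

open WithConv

section Schemes

/-- The algebra of global functions on a scheme over `ℂ`. -/
def GlobalFunctions (S : Over (Spec (.of ℂ))) : Type := Γ(S.left, ⊤)

instance (S : Over (Spec (.of ℂ))) : CommRing (GlobalFunctions S) :=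
  inferInstanceAs (CommRing Γ(S.left, ⊤))

instance (S : Over (Spec (.of ℂ))) : Algebra ℂ (GlobalFunctions S) :=
  ((Scheme.ΓSpecIso (.of ℂ)).inv ≫ S.hom.appTop).hom.toAlgebra

/-- The spectrum of a `ℂ`-algebra as a scheme over `ℂ`. -/
abbrev specOver (B : Type) [CommRing B] [Algebra ℂ B] : Over (Spec (.of ℂ)) :=
  (Spec (.of B)).asOver (Spec (.of ℂ))

/-- The morphism of spectra induced by an algebra map. -/
def specOverMap {B C : Type} [CommRing B] [Algebra ℂ B] [CommRing C] [Algebra ℂ C]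
    (φ : B →ₐ[ℂ] C) : specOver C ⟶ specOver B :=
  (Spec.map (CommRingCat.ofHom φ.toRingHom)).asOver (Spec (.of ℂ))

theorem specOverMap_comp {B C E : Type} [CommRing B] [Algebra ℂ B] [CommRing C] [Algebra ℂ C]
    [CommRing E] [Algebra ℂ E] (φ : B →ₐ[ℂ] C) (ψ : C →ₐ[ℂ] E) :
    specOverMap (ψ.comp φ) = specOverMap ψ ≫ specOverMap φ := by
  ext1
  exact Spec.map_comp (CommRingCat.ofHom φ.toRingHom) (CommRingCat.ofHom ψ.toRingHom)

/-- The canonical morphism to the spectrum of the algebra of global functions. -/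
def toSpecOver (S : Over (Spec (.of ℂ))) : S ⟶ specOver (GlobalFunctions S) :=
  Over.homMk S.left.toSpecΓ (by
    change S.left.toSpecΓ ≫ Spec.map ((Scheme.ΓSpecIso (.of ℂ)).inv ≫ S.hom.appTop) = S.hom
    rw [Spec.map_comp, ← Scheme.toSpecΓ_naturality_assoc, toSpecΓ_SpecMap_ΓSpecIso_inv]
    exact Category.comp_id _)

/-- The `S`-valued point of `Spec B` given by an algebra map. -/
def specPoint (S : Over (Spec (.of ℂ))) {B : Type} [CommRing B] [Algebra ℂ B]
    (φ : B →ₐ[ℂ] GlobalFunctions S) : S ⟶ specOver B :=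
  toSpecOver S ≫ specOverMap φ

theorem specPoint_comp (S : Over (Spec (.of ℂ))) {B C : Type} [CommRing B] [Algebra ℂ B]
    [CommRing C] [Algebra ℂ C] (φ : B →ₐ[ℂ] GlobalFunctions S) (ψ : C →ₐ[ℂ] B) :
    specPoint S φ ≫ specOverMap ψ = specPoint S (φ.comp ψ) := by
  rw [specPoint, specPoint, specOverMap_comp, Category.assoc]

theorem toSpecΓ_SpecMap_appTop {X : Scheme} {B : CommRingCat} (f : X ⟶ Spec B) :
    X.toSpecΓ ≫ Spec.map ((Scheme.ΓSpecIso B).inv ≫ f.appTop) = f := by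
  rw [Spec.map_comp, ← Scheme.toSpecΓ_naturality_assoc, toSpecΓ_SpecMap_ΓSpecIso_inv]
  exact Category.comp_id _

theorem toSpecΓ_SpecMap_injective {X : Scheme} {B : CommRingCat} {φ ψ : B ⟶ Γ(X, ⊤)}
    (h : X.toSpecΓ ≫ Spec.map φ = X.toSpecΓ ≫ Spec.map ψ) : φ = ψ := by
  have key : ∀ φ : B ⟶ Γ(X, ⊤), (ΓSpec.adjunction.homEquiv X (Opposite.op B)) φ.op =
      X.toSpecΓ ≫ Spec.map φ := fun φ => ΓSpec.adjunction.homEquiv_apply ..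
  have h2 := (ΓSpec.adjunction.homEquiv X (Opposite.op B)).injective
    ((key _).trans (h.trans (key _).symm))
  exact Quiver.Hom.op_inj h2

theorem algebraMap_comp_appTop {X : Scheme} {k B : CommRingCat} (i : k ⟶ B) (f : X ⟶ Spec B)
    (p : X ⟶ Spec k) (h : f ≫ Spec.map i = p) :
    i ≫ (Scheme.ΓSpecIso B).inv ≫ f.appTop = (Scheme.ΓSpecIso k).inv ≫ p.appTop := by
  rw [← h, Scheme.Hom.comp_appTop, ← Scheme.ΓSpecIso_inv_naturality_assoc]

/-- This is the `ℂ`-linear form of the adjunction between global functions and `Spec`. Allowing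
every `S` avoids computing the coordinate ring of the categorical product `D.prodIn`. -/
theorem specPoint_bijective (S : Over (Spec (.of ℂ))) (B : Type) [CommRing B] [Algebra ℂ B] :
    Function.Bijective (specPoint S : (B →ₐ[ℂ] GlobalFunctions S) → (S ⟶ specOver B)) := by
  constructor
  · intro φ ψ h
    have h1 : S.left.toSpecΓ ≫ Spec.map (CommRingCat.ofHom φ.toRingHom) =
        S.left.toSpecΓ ≫ Spec.map (CommRingCat.ofHom ψ.toRingHom) :=
      congrArg CommaMorphism.left h
    have h3 := congrArg CommRingCat.Hom.hom (toSpecΓ_SpecMap_injective h1)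
    exact AlgHom.ext fun b => RingHom.congr_fun h3 b
  · intro f
    let f' : S.left ⟶ Spec (.of B) := f.left
    have hf := algebraMap_comp_appTop (CommRingCat.ofHom (algebraMap ℂ B)) f' S.hom (Over.w f)
    refine ⟨⟨((Scheme.ΓSpecIso (.of B)).inv ≫ f'.appTop).hom, fun z => ?_⟩, ?_⟩
    · exact RingHom.congr_fun (congrArg CommRingCat.Hom.hom hf) z
    · ext1
      exact toSpecΓ_SpecMap_appTop f'

section Points

attribute [local instance] Hom.group

variable {A : Type} [CommRing A] [HopfAlgebra ℂ A]

/-- The group of `S`-valued points of `Spec A` as a convolution group. -/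
def specPointHom (S : Over (Spec (.of ℂ))) :
    WithConv (A →ₐ[ℂ] GlobalFunctions S) →* (S ⟶ grp A) where
  toFun φ := specPoint S φ.ofConv
  map_one' := by
    have h := congrArg (fun g => toSpecOver S ≫ g)
      (Spec.mapMulEquiv (R := ℂ) (S := A) (T := GlobalFunctions S)).map_one
    exact h.trans (MonObj.comp_one _)
  map_mul' φ ψ := by
    have h := congrArg (fun g => toSpecOver S ≫ g)
      ((Spec.mapMulEquiv (R := ℂ) (S := A) (T := GlobalFunctions S)).map_mul φ ψ)
    exact h.trans (MonObj.comp_mul ..)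

theorem specPointHom_injective (S : Over (Spec (.of ℂ))) :
    Function.Injective (specPointHom S : WithConv (A →ₐ[ℂ] GlobalFunctions S) →* _) :=
  fun φ ψ h => by
    have := (specPoint_bijective S A).1 h
    exact WithConv.ofConv_injective this

variable {J : Ideal A} {α : Module.Dual ℂ (cartan J)}

theorem specPoint_comp_rootSubgroupIncl (S : Over (Spec (.of ℂ)))
    (φ : (A ⧸ rootSubgroupIdeal J α) →ₐ[ℂ] GlobalFunctions S) :
    (specPoint S φ : S ⟶ rootSubgroup J α) ≫ rootSubgroupIncl J α =
      specPoint S (φ.comp (Ideal.Quotient.mkₐ ℂ _)) :=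
  specPoint_comp S φ (Ideal.Quotient.mkₐ ℂ _)

variable [Algebra.FiniteType ℂ A]

/-- The point of the root subgroup given by an element of the root space. -/
def rootPoint (hα : α ≠ 0) (S : Over (Spec (.of ℂ)))
    (x : rootSpaceOver J α (GlobalFunctions S)) : S ⟶ rootSubgroup J α :=
  specPoint S (Ideal.Quotient.liftₐ (rootSubgroupIdeal J α) (expPoint hα x)
    fun _ hf => expPoint_apply_eq_zero hα x hf)

theorem rootPoint_comp_incl (hα : α ≠ 0) (S : Over (Spec (.of ℂ)))
    (x : rootSpaceOver J α (GlobalFunctions S)) :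
    rootPoint hα S x ≫ rootSubgroupIncl J α = specPointHom S (toConv (expPoint hα x)) :=
  specPoint_comp_rootSubgroupIncl S _

theorem rootPoint_bijective (hα : α ≠ 0) (S : Over (Spec (.of ℂ))) :
    Function.Bijective (rootPoint (J := J) hα S) := by
  constructor
  · intro x y h
    have h1 := congrArg (· ≫ rootSubgroupIncl J α) h
    simp only [rootPoint_comp_incl] at h1
    exact expPoint_injective hα (WithConv.toConv_injective (specPointHom_injective S h1))
  · intro u
    obtain ⟨φ, rfl⟩ := (specPoint_bijective S (A ⧸ rootSubgroupIdeal J α)).2 u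
    obtain ⟨x, hx⟩ := exists_expPoint_eq hα (φ.comp (Ideal.Quotient.mkₐ ℂ _)) fun f hf => by
      rw [AlgHom.comp_apply, Ideal.Quotient.mkₐ_eq_mk, Ideal.Quotient.eq_zero_iff_mem.2 hf,
        map_zero]
    refine ⟨x, congrArg (specPoint S) ?_⟩
    refine AlgHom.ext fun b => ?_
    obtain ⟨f, rfl⟩ := Ideal.Quotient.mk_surjective b
    exact DFunLike.congr_fun hx f

end Points

end Schemes

namespace ScatteringDiagram

variable {A : Type} [CommRing A] [HopfAlgebra ℂ A] {J : Ideal A} (D : ScatteringDiagram J)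

attribute [local instance] Hom.group

theorem comp_stokesProduct (a : Real.Angle) {S S' : Over (Spec (.of ℂ))} (f : S' ⟶ S)
    (u : ∀ γ : D.Cin, S ⟶ rootSubgroup J γ.1) (u' : ∀ γ : D.Cout, S ⟶ rootSubgroup J γ.1) :
    f ≫ D.stokesProduct a u u' =
      D.stokesProduct a (fun γ => f ≫ u γ) (fun γ => f ≫ u' γ) := by
  let F : (S ⟶ grp A) →* (S' ⟶ grp A) :=
    { toFun := fun g => f ≫ g
      map_one' := MonObj.comp_one f
      map_mul' := fun g h => MonObj.comp_mul f g h }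
  change F _ = _
  rw [stokesProduct, stokesProduct, map_list_prod, List.map_map]
  refine congrArg List.prod (List.map_congr_left fun r _ => ?_)
  obtain r | r := r
  · simp only [Function.comp_apply, Sum.elim_inl, map_inv, Category.assoc]
    rfl
  · simp only [Function.comp_apply, Sum.elim_inr, Category.assoc]
    rfl

theorem IsDecoration.precomp {S S' : Over (Spec (.of ℂ))} (f : S' ⟶ S)
    {u : ∀ γ : D.Cin, S ⟶ rootSubgroup J γ.1} {u' : ∀ γ : D.Cout, S ⟶ rootSubgroup J γ.1}
    (h : D.IsDecoration u u') :
    D.IsDecoration (fun γ => f ≫ u γ) (fun γ => f ≫ u' γ) := fun a => by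
  rw [← comp_stokesProduct, h a]
  exact MonObj.comp_one f

theorem existsUnique_isDecoration [Algebra.FiniteType ℂ A] {S : Over (Spec (.of ℂ))}
    (u : ∀ γ : D.Cin, S ⟶ rootSubgroup J γ.1) : ∃! u', D.IsDecoration u u' := by
  choose x hx using fun γ : D.Cin => (rootPoint_bijective (D.inWeight_ne_zero γ) S).2 (u γ)
  have key : ∀ y : ∀ γ : D.Cout, rootSpaceOver J γ.1 (GlobalFunctions S),
      D.IsDecoration u (fun γ => rootPoint (D.outWeight_ne_zero γ) S (y γ)) ↔
      ((D.clockwise 0).map (Sum.elim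
        (fun γ => (toConv (expPoint (D.inWeight_ne_zero γ) (x γ)))⁻¹)
        fun γ => toConv (expPoint (D.outWeight_ne_zero γ) (y γ)))).prod = 1 := by
    intro y
    -- Starting at direction `0` suffices, as triviality of the product is independent of the start.
    have h0 : D.stokesProduct 0 u (fun γ => rootPoint (D.outWeight_ne_zero γ) S (y γ)) =
        specPointHom S ((D.clockwise 0).map (Sum.elim
          (fun γ => (toConv (expPoint (D.inWeight_ne_zero γ) (x γ)))⁻¹)
          fun γ => toConv (expPoint (D.outWeight_ne_zero γ) (y γ)))).prod := by
      rw [stokesProduct, map_list_prod, List.map_map]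
      refine congrArg List.prod (List.map_congr_left fun r _ => ?_)
      obtain r | r := r
      · simp only [Function.comp_apply, Sum.elim_inl, map_inv]
        rw [← hx r]
        exact congrArg _ (rootPoint_comp_incl (D.inWeight_ne_zero r) S (x r))
      · exact rootPoint_comp_incl (D.outWeight_ne_zero r) S (y r)
    rw [← (specPointHom_injective S).eq_iff, ← h0, map_one]
    exact ⟨fun h => h 0, fun h a => (D.stokesProduct_eq_one_iff a 0 _ _).2 h⟩
  obtain ⟨y, hy, hy'⟩ := D.existsUnique_prod_expPoint_eq_one (D.nodup_clockwise 0)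
    (D.mem_clockwise 0) x
  refine ⟨_, (key y).2 hy, fun u' hu' => ?_⟩
  choose z hz using fun γ : D.Cout => (rootPoint_bijective (D.outWeight_ne_zero γ) S).2 (u' γ)
  obtain rfl : (fun γ => rootPoint (D.outWeight_ne_zero γ) S (z γ)) = u' := funext hz
  rw [hy' z ((key z).1 hu')]

end ScatteringDiagram

end StokesScattering

end

/-! ### The solution morphism -/

open StokesScattering in
theorem mainTheorem2 (A : Type) [CommRing A] [HopfAlgebra ℂ A] [Algebra.FiniteType ℂ A]
    (hG : IsReductive A) (J : Ideal A) (hT : IsMaximalTorus J) (D : ScatteringDiagram J) :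
    (∃! s : D.prodIn ⟶ D.prodOut, D.IsSolution s) ∧
    ∀ s : D.prodIn ⟶ D.prodOut, D.IsSolution s →
      ∀ (u : ∀ γ : D.Cin, Over.mk (𝟙 (Spec (.of ℂ))) ⟶ rootSubgroup J γ.1)
        (u' : ∀ γ : D.Cout, Over.mk (𝟙 (Spec (.of ℂ))) ⟶ rootSubgroup J γ.1),
        D.IsDecoration u u' ↔
          ∀ γ : D.Cout, u' γ = Limits.Pi.lift u ≫ s ≫
            Limits.Pi.π (fun γ : D.Cout => rootSubgroup J γ.1) γ := by
  refine ⟨?_, fun s hs u u' => ?_⟩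
  -- Yoneda: a solution is the same as a decoration over `D.prodIn` extending the universal incoming
  -- factors.
  · obtain ⟨u', hu', huniq⟩ := D.existsUnique_isDecoration
      (Limits.Pi.π fun γ : D.Cin => rootSubgroup J γ.1)
    refine ⟨Limits.Pi.lift u', ?_, fun s hs => ?_⟩
    · simpa only [ScatteringDiagram.IsSolution, Limits.Pi.lift_π] using hu'
    · refine Limits.Pi.hom_ext _ _ fun γ => ?_
      rw [Limits.Pi.lift_π, ← huniq _ hs]
  -- Pulled back along the point `u`, the universal decoration becomes one over `Spec ℂ`, where
  -- uniqueness applies again.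
  · have h := ScatteringDiagram.IsDecoration.precomp D (Limits.Pi.lift u) hs
    simp only [Limits.Pi.lift_π] at h
    refine ⟨fun hu' => fun γ => ?_, fun hu' => ?_⟩
    · exact congrFun ((D.existsUnique_isDecoration u).unique hu' h) γ
    · rwa [← funext hu'] at h
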